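/- **Setting.** Let $\mathcal X$ be a measurable space, $t,m\ge 1$ integers, $M_0>0$, $\delta\in(0,1)$, and let $\mathcal P_1,\mathcal P_2,\dots$ be probability distributions on $\mathcal X\times\mathbb R$. In each period $j$ one observes $B_j\ge 1$ samples $z_{j,1},\dots,z_{j,B_j}$ from $\mathcal P_j$, all samples being independent. Assume that for all $j$: (i) $|y|\le M_0$ for $\mathcal P_j$-almost every $(x,y)$; (ii) all the $\mathcal P_j$ have the same marginal distribution $\mathcal P$ on $\mathcal X$. Let $f_1,\dots,f_m:\mathcal X\to[-M_0,M_0]$ be measurable models, with loss $\ell(f,(x,y))=(f(x)-y)^2$. Put $f_j^*(x)=\mathbb E_{\mathcal P_j}(y\mid x)$, $\|h\|_{\mathcal P}=\big(\mathbb E_{x\sim\mathcal P}\,h(x)^2\big)^{1/2}$ and $B_{t,k}=\sum_{j=t-k+1}^t B_j$. **Comparison of two models $f',f''$** (hyperparameters $\delta',M$). Let $u_{j,i}=\ell(f',z_{j,i})-\ell(f'',z_{j,i})$. For $k=1,\dots,t$ let $\widehat\mu_{t,k}=B_{t,k}^{-1}\sum_{j=t-k+1}^t\sum_{i=1}^{B_j}u_{j,i}$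 and $\widehat v_{t,k}^2=(B_{t,k}-1)^{-1}\sum_{j=t-k+1}^t\sum_{i=1}^{B_j}(u_{j,i}-\widehat\mu_{t,k})^2$. Let $\widehat\psi(k)=M$ if $B_{t,k}=1$, and otherwise $$\widehat\psi(k)=\widehat v_{t,k}\sqrt{\frac{2\log(2/\delta')}{B_{t,k}}}+\frac{8M\log(2/\delta')}{3(B_{t,k}-1)};\qquad \widehat\phi(k)=\max_{1\le i\le k}\Big(|\widehat\mu_{t,k}-\widehat\mu_{t,i}|-\widehat\psi(k)-\widehat\psi(i)\Big)_+ .$$ Choose any $\widehat k\in\operatorname{argmin}_{1\le k\le t}\{\widehat\phi(k)+\widehat\psi(k)\}$; return $f'$ if $\widehat\mu_{t,\widehat k}\le 0$ and $f''$ otherwise. **Tournament.** Start with all $m$ models. In each of $\lceil\log_2 m\rceil$ rounds, split the remaining models into pairs in an arbitrary way (at most one model stays unpaired and advances), compare the two models of each pair, and keep the winners. Output the single remaining model $\widehat f$. **Theorem (Oracle inequality).** Run the tournament with $\delta'=\delta/(3m^2t)$ and $M=8M_0^2$ (the length of the interval $[-4M_0^2,4M_0^2]$ that contains all loss differences). There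 are a universal exponent $p\in\mathbb N$ and a constant $C>0$ depending only on $M_0$ such that, with probability at least $1-\delta$, the tournament has an output, and every possible output $\widehat f$ (for all choices of $\widehat k$ and of the pairs) satisfies $$\|\widehat f-f_t^*\|_{\mathcal P}-\min_{1\le r\le m}\|f_r-f_t^*\|_{\mathcal P}\le C\,\Lambda^p\min_{1\le k\le t}\Big\{\max_{t-k+1\le j\le t}\|f_j^*-f_t^*\|_{\mathcal P}+\frac1{\sqrt{B_{t,k}}}\Big\},$$ where $\Lambda=(1+\log m)(1+\log t)(1+\log(1/\delta))$. -/

import Mathlib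

open MeasureTheory ProbabilityTheory

noncomputable section

namespace RollingWindow

/-- The periods `t-k+1, …, t` (for `1 ≤ k ≤ t`). -/
def window (t k : ℕ) : Finset ℕ := Finset.Icc (t - k + 1) t

/-- `B_{t,k}`, the number of samples in the `k` most recent periods. -/
def winSize (B : ℕ → ℕ) (t k : ℕ) : ℕ := ∑ j ∈ window t k, B j

/-! ### Adaptive rolling window for mean estimation -/

section Mean

variable {B : ℕ → ℕ}

/-- The rolling-window sample mean. -/
def winMean (u : (j : ℕ) → Fin (B j) → ℝ) (t k : ℕ) : ℝ :=
  (winSize B t k : ℝ)⁻¹ * ∑ j ∈ window t k, ∑ i : Fin (B j), u j i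

/-- The rolling-window sample variance. -/
def winVar (u : (j : ℕ) → Fin (B j) → ℝ) (t k : ℕ) : ℝ :=
  ((winSize B t k : ℝ) - 1)⁻¹ *
    ∑ j ∈ window t k, ∑ i : Fin (B j), (u j i - winMean u t k) ^ 2

/-- The proxy `ψ̂(t, k, δ')` for the stochastic error, with hyperparameter `M`. -/
def psiHat (u : (j : ℕ) → Fin (B j) → ℝ) (M δ' : ℝ) (t k : ℕ) : ℝ :=
  if winSize B t k = 1 then M
  else
    Real.sqrt (winVar u t k) * Real.sqrt (2 * Real.log (2 / δ') / winSize B t k)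
      + 8 * M * Real.log (2 / δ') / (3 * ((winSize B t k : ℝ) - 1))

/-- The proxy `φ̂(t, k, δ')` for the bias: a maximum over the windows `i = 1, …, k`. -/
def phiHat (u : (j : ℕ) → Fin (B j) → ℝ) (M δ' : ℝ) (t k : ℕ) : ℝ :=
  ⨆ i : Finset.Icc 1 k,
    max (|winMean u t k - winMean u t i| - (psiHat u M δ' t k + psiHat u M δ' t i)) 0

/-- `k` is a minimizer of `φ̂ + ψ̂` over the windows `1, …, t`. -/
def IsSelectedWindow (u : (j : ℕ) → Fin (B j) → ℝ) (M δ' : ℝ) (t k : ℕ) : Prop :=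
  k ∈ Finset.Icc 1 t ∧ ∀ k' ∈ Finset.Icc 1 t,
    phiHat u M δ' t k + psiHat u M δ' t k ≤ phiHat u M δ' t k' + psiHat u M δ' t k'

end Mean

/-! ### Pairwise comparison and single-elimination tournament -/

section Selection

variable {X : Type*} {B : ℕ → ℕ} {m : ℕ}

/-- The square loss. -/
def sqLoss (f : X → ℝ) (z : X × ℝ) : ℝ := (f z.1 - z.2) ^ 2

/-- The differences of the losses of two models on the data. -/
def lossDiff (data : (j : ℕ) → Fin (B j) → X × ℝ) (f₁ f₂ : X → ℝ) :
    (j : ℕ) → Fin (B j) → ℝ :=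
  fun j i => sqLoss f₁ (data j i) - sqLoss f₂ (data j i)

/-- `c` is a possible result of comparing model `a` (first) with model `b` (second): some
minimizing window `k` is chosen, and `a` wins if and only if the estimated gap is `≤ 0`. -/
def IsComparisonOutput (data : (j : ℕ) → Fin (B j) → X × ℝ) (M δ' : ℝ) (t : ℕ)
    (f : Fin m → X → ℝ) (a b c : Fin m) : Prop :=
  ∃ k, IsSelectedWindow (lossDiff data (f a) (f b)) M δ' t k ∧
    c = if winMean (lossDiff data (f a) (f b)) t k ≤ 0 then a else b

/-- One round of pairwise comparisons: `IsRound cmp l l'` says that, pairing consecutive members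
of `l`, the winners (and the unpaired last member, if the length is odd) form `l'`. -/
inductive IsRound {ι : Type*} (cmp : ι → ι → ι → Prop) : List ι → List ι → Prop
  | nil : IsRound cmp [] []
  | bye (a : ι) : IsRound cmp [a] [a]
  | pair {a b c : ι} {l l' : List ι} :
      cmp a b c → IsRound cmp l l' → IsRound cmp (a :: b :: l) (c :: l')

/-- `n` successive rounds. Before each round the remaining models are put in an arbitrary order,
so every splitting into pairs is allowed. -/
inductive IsRounds {ι : Type*} (cmp : ι → ι → ι → Prop) : ℕ → List ι → List ι → Prop
  | zero (l : List ι) : IsRounds cmp 0 l l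
  | succ {n : ℕ} {l l₁ l₂ l₃ : List ι} :
      l.Perm l₁ → IsRound cmp l₁ l₂ → IsRounds cmp n l₂ l₃ → IsRounds cmp (n + 1) l l₃

/-- `r` is a possible output of the single-elimination tournament over the models
`f 0, …, f (m-1)`, with `⌈log₂ m⌉` rounds. -/
def IsTournamentOutput (data : (j : ℕ) → Fin (B j) → X × ℝ) (M δ' : ℝ) (t : ℕ)
    (f : Fin m → X → ℝ) (r : Fin m) : Prop :=
  IsRounds (IsComparisonOutput data M δ' t f) (Nat.clog 2 m) (List.finRange m) [r]

end Selection

/-! ### Regression functions and the error norm -/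

section Regression

variable {X : Type*} [MeasurableSpace X]

/-- The regression function `x ↦ E(y | x)` of a distribution of `(x, y)`. -/
def regFun (P : Measure (X × ℝ)) [IsFiniteMeasure P] (x : X) : ℝ :=
  ∫ y, y ∂(P.condKernel x)

/-- The norm `‖h‖_P`. -/
def l2norm (PX : Measure X) (h : X → ℝ) : ℝ := Real.sqrt (∫ x, h x * h x ∂PX)

end Regression

end RollingWindow

end

/-! The difference of the losses of two models `f_a`, `f_b` has mean `‖f_a - f*‖² - ‖f_b - f*‖²`, so
a comparison is the estimation of a mean under drift. The threshold `ψ̂` is a valid deviation bound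
by the empirical Bernstein inequality. For this the sample variance has to be bounded below: the
sample, indexed by `ℤ/n`, splits into the pairs with `i + j = c`, which makes the sample variance an
average over `c` of sums of independent squares, and concentration below the mean survives such
averages whatever their dependence. On the event that all means and sample variances concentrate,
the selected window competes with every other window, as in Lepski's method.

The variance of the loss difference is of order `‖f_a - f_b‖²`, which is at most the square of
`‖f_a - f*‖ + ‖f_b - f*‖`. Hence a comparison lost by the better model `b` gives
`x² - y² ≤ C ((x + y) ε + ε²)` for the errors `x` and `y` of `a` and `b`, where `ε` is the drift
plus the statistical error, and therefore `x ≤ y + (C + 1) ε`. Thus each of the `⌈log₂ m⌉` rounds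
costs a multiple of `ε`, rather than the `√ε` that a bound on the squared errors would give. -/

namespace RollingWindow

open Real

/-! ### Bernstein's inequality -/

theorem exp_neg_le_quadratic {x : ℝ} (hx : 0 ≤ x) : exp (-x) ≤ 1 - x + x ^ 2 / 2 := by
  have hpos : 0 < 1 + x + x ^ 2 / 2 := by positivity
  calc exp (-x) = (exp x)⁻¹ := exp_neg x
    _ ≤ (1 + x + x ^ 2 / 2)⁻¹ := inv_anti₀ hpos (quadratic_le_exp_of_nonneg hx)
    _ ≤ 1 - x + x ^ 2 / 2 := by
      rw [inv_le_iff_one_le_mul₀ hpos]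
      nlinarith [sq_nonneg (x ^ 2)]

theorem exp_le_one_add_add_sq_div {x b : ℝ} (hx : |x| ≤ b) (hb : b < 3) :
    exp x ≤ 1 + x + x ^ 2 / (2 * (1 - b / 3)) := by
  have hb0 : 0 ≤ b := (abs_nonneg x).trans hx
  have hasSum_tail : HasSum (fun n : ℕ => x ^ (n + 2) / ((n + 2).factorial : ℝ))
      (exp x - (1 + x)) := by
    have h := NormedSpace.expSeries_div_hasSum_exp x
    rw [← Real.exp_eq_exp_ℝ, ← hasSum_nat_add_iff' 2] at h
    simpa [Finset.sum_range_succ] using h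
  have hasSum_geometric : HasSum (fun n : ℕ => x ^ 2 / 2 * (b / 3) ^ n)
      (x ^ 2 / 2 * (1 - b / 3)⁻¹) :=
    (hasSum_geometric_of_lt_one (by positivity) (by linarith)).mul_left _
  have term_le (n : ℕ) : x ^ (n + 2) / ((n + 2).factorial : ℝ) ≤ x ^ 2 / 2 * (b / 3) ^ n := by
    have factorial_ge : (2 * 3 ^ n : ℝ) ≤ (n + 2).factorial := by
      have h := Nat.factorial_mul_pow_le_factorial (m := 2) (n := n)
      rw [Nat.factorial_two, Nat.add_comm 2 n] at h
      exact_mod_cast h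
    calc x ^ (n + 2) / ((n + 2).factorial : ℝ) ≤ |x| ^ (n + 2) / (n + 2).factorial := by
          refine div_le_div_of_nonneg_right ?_ (by positivity)
          exact (le_abs_self _).trans_eq (abs_pow x _)
      _ ≤ |x| ^ (n + 2) / (2 * 3 ^ n) := by gcongr
      _ = x ^ 2 / 2 * (|x| / 3) ^ n := by rw [pow_add, sq_abs, div_pow]; field_simp
      _ ≤ x ^ 2 / 2 * (b / 3) ^ n := by gcongr
  have h := hasSum_le term_le hasSum_tail hasSum_geometric
  rw [div_mul_eq_div_div, div_eq_mul_inv (x ^ 2 / 2)]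
  linarith

section Bernstein

variable {Ω : Type*} [MeasurableSpace Ω] {μ : Measure Ω}

theorem mgf_le_exp_of_abs_le [IsProbabilityMeasure μ] {X : Ω → ℝ} (hX : AEMeasurable X μ)
    {M l : ℝ} (hM : ∀ᵐ ω ∂μ, |X ω| ≤ M) (hl : 0 ≤ l) (hlM : l * M < 3) :
    mgf X μ l ≤ exp (l * μ[X] + l ^ 2 / (2 * (1 - l * M / 3)) * ∫ ω, X ω ^ 2 ∂μ) := by
  set q := l ^ 2 / (2 * (1 - l * M / 3)) with hq
  have hX_int : Integrable X μ := .of_bound hX.aestronglyMeasurable M hM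
  have hX_sq : Integrable (fun ω => X ω ^ 2) μ :=
    (memLp_of_bounded (hM.mono fun _ => abs_le.1) hX.aestronglyMeasurable 2).integrable_sq
  calc mgf X μ l ≤ ∫ ω, (1 + l * X ω + q * X ω ^ 2) ∂μ := by
        refine integral_mono_ae (integrable_exp_mul_of_mem_Icc hX (hM.mono fun _ => abs_le.1))
          (by fun_prop) ?_
        filter_upwards [hM] with ω hω
        have hlX : |l * X ω| ≤ l * M := by rw [abs_mul, abs_of_nonneg hl]; gcongr
        refine (exp_le_one_add_add_sq_div hlX hlM).trans_eq ?_
        rw [hq]; ring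
    _ = l * μ[X] + q * ∫ ω, X ω ^ 2 ∂μ + 1 := by
        rw [integral_add (by fun_prop) (by fun_prop), integral_add (by fun_prop) (by fun_prop),
          integral_const_mul, integral_const_mul, integral_const, probReal_univ, one_smul]
        ring
    _ ≤ exp (l * μ[X] + q * ∫ ω, X ω ^ 2 ∂μ) := add_one_le_exp _

variable {ι : Type*} [Fintype ι] {X : ι → Ω → ℝ}

theorem mgf_sum_le_exp_sum (hX : iIndepFun X μ) (hm : ∀ i, Measurable (X i)) {l : ℝ} {c : ι → ℝ}
    (hc : ∀ i, mgf (X i) μ l ≤ exp (c i)) :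
    mgf (fun ω => ∑ i, X i ω) μ l ≤ exp (∑ i, c i) := by
  have h : mgf (fun ω => ∑ i, X i ω) μ l = ∏ i, mgf (X i) μ l := by
    rw [← hX.mgf_sum hm Finset.univ]
    exact congrArg (mgf · μ l) (Finset.sum_fn _ _).symm
  rw [h, exp_sum]
  exact Finset.prod_le_prod (fun _ _ => mgf_nonneg) fun i _ => hc i

theorem measureReal_sum_ge_le_of_mgf_le (hX : iIndepFun X μ) (hm : ∀ i, Measurable (X i))
    {l : ℝ} (hl : 0 ≤ l) (hint : ∀ i, Integrable (fun ω => exp (l * X i ω)) μ) {c : ι → ℝ}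
    (hc : ∀ i, mgf (X i) μ l ≤ exp (c i)) (ε : ℝ) :
    μ.real {ω | ε ≤ ∑ i, X i ω} ≤ exp (∑ i, c i - l * ε) := by
  have := hX.isProbabilityMeasure
  have hint_sum : Integrable (fun ω => exp (l * ∑ i, X i ω)) μ := by
    simpa only [Finset.sum_apply] using
      hX.integrable_exp_mul_sum hm (s := Finset.univ) fun i _ => hint i
  calc μ.real {ω | ε ≤ ∑ i, X i ω}
      ≤ exp (-l * ε) * mgf (fun ω => ∑ i, X i ω) μ l := measure_ge_le_exp_mul_mgf ε hl hint_sum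
    _ ≤ exp (-l * ε) * exp (∑ i, c i) := by gcongr; exact mgf_sum_le_exp_sum hX hm hc
    _ = exp (∑ i, c i - l * ε) := by rw [← exp_add]; ring_nf

/-- The Legendre transform of the Bernstein bound `l² v / (2 (1 - c l))`. -/
theorem exists_bernstein_rate {v c L : ℝ} (hv : 0 < v) (hc : 0 ≤ c) (hL : 0 < L) :
    ∃ l, 0 ≤ l ∧ c * l < 1 ∧ l ^ 2 / (2 * (1 - c * l)) * v - l * (√(2 * v * L) + c * L) = -L := by
  obtain ⟨r, hr, hvr⟩ : ∃ r, 0 < r ∧ v * r ^ 2 = 2 * L :=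
    ⟨√(2 * L / v), by positivity, by rw [sq_sqrt (by positivity)]; field_simp⟩
  have hsqrt : √(2 * v * L) = v * r := by
    rw [show 2 * v * L = (v * r) ^ 2 by linear_combination (-v) * hvr, sqrt_sq (by positivity)]
  have hden : 0 < 1 + c * r := by positivity
  have hrate : 1 - c * (r / (1 + c * r)) = (1 + c * r)⁻¹ := by field_simp; ring
  refine ⟨r / (1 + c * r), by positivity, ?_, ?_⟩
  · linarith [inv_pos.2 hden]
  · rw [hrate, hsqrt]
    field_simp
    linear_combination (-1) * hvr

theorem measureReal_bernstein_le (hX : iIndepFun X μ) (hm : ∀ i, Measurable (X i))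
    {M L : ℝ} (hM : 0 < M) (hb : ∀ i, ∀ᵐ ω ∂μ, |X i ω - μ[X i]| ≤ M) (hL : 0 < L) :
    μ.real {ω | √(2 * (∑ i, Var[X i; μ]) * L) + M / 3 * L ≤ ∑ i, (X i ω - μ[X i])}
      ≤ exp (-L) := by
  have := hX.isProbabilityMeasure
  have hbdd (i) : ∀ᵐ ω ∂μ, X i ω - μ[X i] ∈ Set.Icc (-M) M := (hb i).mono fun _ => abs_le.1
  have hmem (i) : MemLp (X i) 2 μ := by
    refine memLp_of_bounded (a := μ[X i] - M) (b := μ[X i] + M) ?_ (by fun_prop) 2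
    filter_upwards [hbdd i] with ω hω
    exact ⟨by linarith [hω.1], by linarith [hω.2]⟩
  obtain hv | hv := (Finset.sum_nonneg fun i _ => variance_nonneg (X i) μ).eq_or_lt
  · have hconst : ∀ᵐ ω ∂μ, ∀ i, X i ω = μ[X i] := by
      refine ae_all_iff.2 fun i => ae_eq_integral_of_variance_eq_zero (hmem i) ?_
      exact (Finset.sum_eq_zero_iff_of_nonneg fun i _ => variance_nonneg (X i) μ).1 hv.symm i
        (Finset.mem_univ i)
    have hnull : μ {ω | √(2 * (∑ i, Var[X i; μ]) * L) + M / 3 * L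
        ≤ ∑ i, (X i ω - μ[X i])} = 0 := by
      refine measure_eq_zero_iff_ae_notMem.2 (hconst.mono fun ω hω => ?_)
      simp only [Set.mem_ofPred_eq, hω, sub_self, Finset.sum_const_zero, not_le]
      positivity
    rw [measureReal_def, hnull, ENNReal.toReal_zero]
    positivity
  · obtain ⟨l, hl, hcl, hrate⟩ := exists_bernstein_rate hv (c := M / 3) (by positivity) hL
    have hcenter (i) : ∫ ω, (X i ω - μ[X i]) ∂μ = 0 := by
      rw [integral_sub ((hmem i).integrable one_le_two) (integrable_const _)]
      simp
    have hmgf (i) : mgf (fun ω => X i ω - μ[X i]) μ l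
        ≤ exp (l ^ 2 / (2 * (1 - M / 3 * l)) * Var[X i; μ]) := by
      refine (mgf_le_exp_of_abs_le (by fun_prop) (hb i) hl (by linarith)).trans_eq ?_
      rw [hcenter, variance_eq_integral (hm i).aemeasurable, mul_zero, zero_add, mul_comm l,
        mul_div_right_comm]
    have hindep : iIndepFun (fun i ω => X i ω - μ[X i]) μ :=
      hX.comp (fun i (x : ℝ) => x - ∫ ω, X i ω ∂μ) fun i => by fun_prop
    refine (measureReal_sum_ge_le_of_mgf_le hindep (fun i => by fun_prop) hl
      (fun i => integrable_exp_mul_of_mem_Icc (by fun_prop) (hbdd i)) hmgf _).trans_eq ?_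
    rw [← Finset.mul_sum, hrate]

/-- Chernoff's bound at rate `1 / b`: as `X i ^ 2 ≤ b * X i`, the second moment in the bound on the
Laplace transform is absorbed by the mean. -/
theorem measureReal_sum_ge_two_mul_integral_add_le (hX : iIndepFun X μ)
    (hm : ∀ i, Measurable (X i)) {b : ℝ} (hb : 0 < b)
    (hX_mem : ∀ i, ∀ᵐ ω ∂μ, X i ω ∈ Set.Icc 0 b) (L : ℝ) :
    μ.real {ω | 2 * ∑ i, μ[X i] + b * L ≤ ∑ i, X i ω} ≤ exp (-L) := by
  have := hX.isProbabilityMeasure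
  have hmgf (i) : mgf (X i) μ b⁻¹ ≤ exp (2 / b * μ[X i]) := by
    have habs : ∀ᵐ ω ∂μ, |X i ω| ≤ b :=
      (hX_mem i).mono fun ω hω => by rw [abs_of_nonneg hω.1]; exact hω.2
    have hsq : ∫ ω, X i ω ^ 2 ∂μ ≤ b * μ[X i] := by
      rw [← integral_const_mul]
      refine integral_mono_ae ?_ ?_ ((hX_mem i).mono fun ω hω => ?_)
      · exact (memLp_of_bounded (hX_mem i) (hm i).aestronglyMeasurable 2).integrable_sq
      · exact ((memLp_of_bounded (hX_mem i) (hm i).aestronglyMeasurable 1).integrable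
          le_rfl).const_mul b
      · exact (sq (X i ω)).trans_le (mul_le_mul_of_nonneg_right hω.2 hω.1)
    have hmean : 0 ≤ μ[X i] := integral_nonneg_of_ae ((hX_mem i).mono fun ω hω => hω.1)
    have hone : b⁻¹ * b = 1 := inv_mul_cancel₀ hb.ne'
    refine (mgf_le_exp_of_abs_le (hm i).aemeasurable habs (by positivity)
      (by rw [hone]; norm_num)).trans (exp_le_exp.2 ?_)
    rw [hone]
    calc b⁻¹ * μ[X i] + b⁻¹ ^ 2 / (2 * (1 - 1 / 3)) * ∫ ω, X i ω ^ 2 ∂μ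
        ≤ b⁻¹ * μ[X i] + b⁻¹ ^ 2 / (2 * (1 - 1 / 3)) * (b * μ[X i]) := by
          gcongr
      _ = 7 / 4 * (μ[X i] / b) := by field_simp; ring
      _ ≤ 2 / b * μ[X i] := by
          have : 0 ≤ μ[X i] / b := by positivity
          calc 7 / 4 * (μ[X i] / b) ≤ 2 * (μ[X i] / b) := by linarith
            _ = 2 / b * μ[X i] := by ring
  refine (measureReal_sum_ge_le_of_mgf_le hX hm (inv_nonneg.2 hb.le)
    (fun i => integrable_exp_mul_of_mem_Icc (hm i).aemeasurable (hX_mem i)) hmgf _).trans_eq ?_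
  rw [← Finset.mul_sum]
  congr 1
  field_simp
  ring

end Bernstein
/-! ### Lower tails of self-bounding variables -/

section SelfBounding

variable {Ω : Type*} [MeasurableSpace Ω] {μ : Measure Ω}

/-- A nonnegative random variable whose Laplace transform is at most `exp (-(θ - θ² b / 2) 𝔼 Z)`,
the bound that holds for variables with values in `[0, b]`. It expresses sub-Gaussian
concentration below the mean with variance proxy `b 𝔼 Z`, and is stable under independent sums and
under convex combinations of arbitrarily dependent variables. -/
structure HasSelfBoundingLowerMGF (Z : Ω → ℝ) (b : ℝ) (μ : Measure Ω) : Prop where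
  integrable : Integrable Z μ
  nonneg : ∀ᵐ ω ∂μ, 0 ≤ Z ω
  mgf_neg_le : ∀ θ, 0 ≤ θ → mgf Z μ (-θ) ≤ exp (-(θ - θ ^ 2 * b / 2) * μ[Z])

namespace HasSelfBoundingLowerMGF

theorem integrable_exp_neg_mul [IsFiniteMeasure μ] {Z : Ω → ℝ} {b θ : ℝ}
    (hZ : HasSelfBoundingLowerMGF Z b μ) (hθ : 0 ≤ θ) :
    Integrable (fun ω => exp (-θ * Z ω)) μ := by
  have hm : AEMeasurable Z μ := hZ.integrable.aemeasurable
  refine .of_bound (by fun_prop) 1 (hZ.nonneg.mono fun ω hω => ?_)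
  rw [norm_of_nonneg (exp_nonneg _), exp_le_one_iff, neg_mul]
  exact neg_nonpos.2 (mul_nonneg hθ hω)

theorem of_mem_Icc [IsProbabilityMeasure μ] {Z : Ω → ℝ} {b : ℝ} (hm : AEMeasurable Z μ)
    (hZ : ∀ᵐ ω ∂μ, Z ω ∈ Set.Icc 0 b) : HasSelfBoundingLowerMGF Z b μ where
  integrable := Integrable.of_mem_Icc 0 b hm hZ
  nonneg := hZ.mono fun _ => And.left
  mgf_neg_le θ hθ := by
    have hint : Integrable Z μ := Integrable.of_mem_Icc 0 b hm hZ
    calc mgf Z μ (-θ) ≤ ∫ ω, (1 - (θ - θ ^ 2 * b / 2) * Z ω) ∂μ := by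
          refine integral_mono_ae (integrable_exp_mul_of_mem_Icc hm hZ) (by fun_prop) ?_
          filter_upwards [hZ] with ω ⟨h0, hb⟩
          have hsq : θ ^ 2 * (Z ω * Z ω) ≤ θ ^ 2 * (b * Z ω) := by gcongr
          have hexp := exp_neg_le_quadratic (mul_nonneg hθ h0)
          rw [neg_mul]
          linarith [mul_pow θ (Z ω) 2, sq (Z ω)]
      _ = -(θ - θ ^ 2 * b / 2) * μ[Z] + 1 := by
          rw [integral_sub (by fun_prop) (by fun_prop), integral_const_mul, integral_const,
            probReal_univ, one_smul]
          ring
      _ ≤ exp (-(θ - θ ^ 2 * b / 2) * μ[Z]) := add_one_le_exp _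

variable {ι : Type*} [Fintype ι] {Z : ι → Ω → ℝ} {b : ℝ}

theorem sum (hZ : ∀ i, HasSelfBoundingLowerMGF (Z i) b μ) (hindep : iIndepFun Z μ)
    (hm : ∀ i, Measurable (Z i)) : HasSelfBoundingLowerMGF (fun ω => ∑ i, Z i ω) b μ where
  integrable := integrable_finsetSum _ fun i _ => (hZ i).integrable
  nonneg := (ae_all_iff.2 fun i => (hZ i).nonneg).mono fun _ hω =>
    Finset.sum_nonneg fun i _ => hω i
  mgf_neg_le θ hθ := by
    rw [integral_finsetSum _ fun i _ => (hZ i).integrable, Finset.mul_sum]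
    exact mgf_sum_le_exp_sum hindep hm fun i => (hZ i).mgf_neg_le θ hθ

theorem convex_sum [IsFiniteMeasure μ] (hZ : ∀ i, HasSelfBoundingLowerMGF (Z i) b μ) {w : ι → ℝ}
    (hw : ∀ i, 0 ≤ w i) (hw_sum : ∑ i, w i = 1) :
    HasSelfBoundingLowerMGF (fun ω => ∑ i, w i * Z i ω) b μ where
  integrable := integrable_finsetSum _ fun i _ => (hZ i).integrable.const_mul _
  nonneg := (ae_all_iff.2 fun i => (hZ i).nonneg).mono fun _ hω =>
    Finset.sum_nonneg fun i _ => mul_nonneg (hw i) (hω i)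
  mgf_neg_le θ hθ := by
    set κ := θ - θ ^ 2 * b / 2
    set W := ∫ ω, ∑ i, w i * Z i ω ∂μ with hW
    have hWsum : W = ∑ i, w i * μ[Z i] := by
      rw [hW, integral_finsetSum _ fun i _ => (hZ i).integrable.const_mul _]
      simp only [integral_const_mul]
    have hint (i) : Integrable (fun ω => w i * (exp (κ * μ[Z i]) * exp (-θ * Z i ω))) μ :=
      (((hZ i).integrable_exp_neg_mul hθ).const_mul _).const_mul _
    -- Jensen's inequality, applied to the exponents recentred so that each term has mean `≤ 1`
    have hjensen (ω) : exp (κ * W) * exp (-θ * ∑ i, w i * Z i ω)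
        ≤ ∑ i, w i * (exp (κ * μ[Z i]) * exp (-θ * Z i ω)) := by
      have h := convexOn_exp.map_sum_le (t := Finset.univ) (w := w)
        (p := fun i => κ * μ[Z i] + -θ * Z i ω) (fun i _ => hw i) hw_sum fun _ _ => Set.mem_univ _
      simp only [smul_eq_mul, mul_add, Finset.sum_add_distrib, exp_add, mul_left_comm (w _),
        ← Finset.mul_sum, ← hWsum] at h
      exact h.trans_eq (Finset.sum_congr rfl fun i _ => mul_left_comm _ _ _)
    have hterm (i) : exp (κ * μ[Z i]) * mgf (Z i) μ (-θ) ≤ 1 := by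
      calc exp (κ * μ[Z i]) * mgf (Z i) μ (-θ) ≤ exp (κ * μ[Z i]) * exp (-κ * μ[Z i]) := by
            gcongr; exact (hZ i).mgf_neg_le θ hθ
        _ = 1 := by rw [← exp_add, neg_mul, add_neg_cancel, exp_zero]
    have hnormalized : exp (κ * W) * mgf (fun ω => ∑ i, w i * Z i ω) μ (-θ) ≤ 1 := by
      calc exp (κ * W) * mgf (fun ω => ∑ i, w i * Z i ω) μ (-θ)
          = ∫ ω, exp (κ * W) * exp (-θ * ∑ i, w i * Z i ω) ∂μ := (integral_const_mul _ _).symm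
        _ ≤ ∫ ω, ∑ i, w i * (exp (κ * μ[Z i]) * exp (-θ * Z i ω)) ∂μ :=
            integral_mono_of_nonneg (ae_of_all _ fun ω => by positivity)
              (integrable_finsetSum _ fun i _ => hint i) (ae_of_all _ hjensen)
        _ = ∑ i, w i * (exp (κ * μ[Z i]) * mgf (Z i) μ (-θ)) := by
            rw [integral_finsetSum _ fun i _ => hint i]
            simp only [integral_const_mul, mgf]
        _ ≤ ∑ i, w i * 1 := by gcongr with i; exacts [hw i, hterm i]
        _ = 1 := by simp only [mul_one, hw_sum]
    rwa [neg_mul, exp_neg, ← one_div, le_div_iff₀' (exp_pos _)]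

theorem measureReal_sqrt_add_lt_sqrt_integral_le [IsFiniteMeasure μ] {Z : Ω → ℝ} {L : ℝ}
    (hZ : HasSelfBoundingLowerMGF Z b μ) (hb : 0 < b) (hL : 0 ≤ L) :
    μ.real {ω | √(Z ω) + √(2 * b * L) < √(μ[Z])} ≤ exp (-L) := by
  set r := √(2 * b * L)
  set w := √(μ[Z])
  have hr : r ^ 2 = 2 * b * L := sq_sqrt (by positivity)
  have hw : w ^ 2 = μ[Z] := sq_sqrt (integral_nonneg_of_ae hZ.nonneg)
  obtain hrw | hrw := le_or_gt w r
  · have hempty : {ω | √(Z ω) + r < w} = ∅ := by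
      ext ω
      simpa using hrw.trans (le_add_of_nonneg_left (sqrt_nonneg (Z ω)))
    rw [hempty, measureReal_empty]
    positivity
  have hw_pos : 0 < w := (sqrt_nonneg _).trans_lt hrw
  set θ := r / (b * w)
  have hθ : 0 ≤ θ := by positivity
  have hsubset : {ω | √(Z ω) + r < w} ⊆ {ω | Z ω ≤ (w - r) ^ 2} := fun ω (hω : √(Z ω) + r < w) =>
    ((sqrt_lt' (sub_pos.2 hrw)).1 (lt_sub_iff_add_lt.2 hω)).le
  have hexponent : θ * (w - r) ^ 2 + -(θ - θ ^ 2 * b / 2) * w ^ 2 ≤ -L := by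
    have hL_eq : L = r ^ 2 / (2 * b) := by rw [hr]; field_simp
    calc θ * (w - r) ^ 2 + -(θ - θ ^ 2 * b / 2) * w ^ 2
        = r ^ 2 / b * (r / w) - 3 * r ^ 2 / (2 * b) := by simp only [θ]; field_simp; ring
      _ ≤ r ^ 2 / b * 1 - 3 * r ^ 2 / (2 * b) := by
          gcongr
          exact (div_le_one hw_pos).2 hrw.le
      _ = -L := by rw [hL_eq]; ring
  calc μ.real {ω | √(Z ω) + r < w} ≤ μ.real {ω | Z ω ≤ (w - r) ^ 2} := measureReal_mono hsubset
    _ ≤ exp (- -θ * (w - r) ^ 2) * mgf Z μ (-θ) :=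
        measure_le_le_exp_mul_mgf _ (neg_nonpos.2 hθ) (hZ.integrable_exp_neg_mul hθ)
    _ ≤ exp (- -θ * (w - r) ^ 2) * exp (-(θ - θ ^ 2 * b / 2) * μ[Z]) := by
        gcongr; exact hZ.mgf_neg_le θ hθ
    _ ≤ exp (-L) := by
        rw [← exp_add, neg_neg, ← hw]
        exact exp_le_exp.2 hexponent

end HasSelfBoundingLowerMGF

end SelfBounding

/-! ### The sample variance -/

section PairIndependence

variable {Ω : Type*} [MeasurableSpace Ω] {μ : Measure Ω}

theorem iIndepFun_curry {ι : Type*} {κ : ι → Type*} {E : (i : ι) → κ i → Type*}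
    [∀ i j, MeasurableSpace (E i j)] {X : (i : ι) → (j : κ i) → Ω → E i j}
    (hX : iIndepFun (fun (p : (i : ι) × κ i) => X p.1 p.2) μ) (hm : ∀ i j, Measurable (X i j)) :
    iIndepFun (fun i ω j => X i j ω) μ := by
  have := hX.isProbabilityMeasure
  have hprob (i j) : IsProbabilityMeasure (μ.map (X i j)) :=
    Measure.isProbabilityMeasure_map (hm i j).aemeasurable
  have hblock (i) : iIndepFun (X i) μ :=
    hX.precomp (g := fun j => ⟨i, j⟩) sigma_mk_injective
  have hcurry : MeasurableEquiv.piCurry E ∘ (fun ω p => X p.1 p.2 ω) = fun ω i j => X i j ω := rfl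
  rw [iIndepFun_iff_map_fun_eq_infinitePi_map (by fun_prop)] at hX ⊢
  rw [← hcurry, ← Measure.map_map (by fun_prop) (by fun_prop), hX,
    Measure.infinitePi_map_piCurry fun i j => μ.map (X i j)]
  refine congrArg Measure.infinitePi (funext fun i => ?_)
  exact ((iIndepFun_iff_map_fun_eq_infinitePi_map (by fun_prop)).1 (hblock i)).symm

/-- The indices `i` from which each unordered pair `{i, j}` with `i + j = c`, `i ≠ j` is listed
once. For varying `c` these sets list every unordered pair, and for fixed `c` the pairs are
disjoint. -/
abbrev ReflectionPairs (n : ℕ) (c : ZMod n) : Type := {i : ZMod n // i.val < (c - i).val}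

theorem iIndepFun_reflectionPairs {E F : Type*} [MeasurableSpace E] [MeasurableSpace F] {n : ℕ}
    {X : ZMod n → Ω → E} (hX : iIndepFun X μ) (hm : ∀ i, Measurable (X i)) (c : ZMod n)
    {φ : E → E → F} (hφ : Measurable φ.uncurry) :
    iIndepFun (fun (i : ReflectionPairs n c) ω => φ (X i ω) (X (c - i) ω)) μ := by
  let e : (_ : ReflectionPairs n c) × Bool → ZMod n := fun p => if p.2 then p.1 else c - p.1
  have he : e.Injective := by
    rintro ⟨⟨i, hi⟩, a⟩ ⟨⟨j, hj⟩, b⟩ hij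
    cases a <;> cases b <;> simp only [e, Bool.false_eq_true, if_false, if_true] at hij
    · obtain rfl : i = j := by simpa using hij
      rfl
    · subst hij
      simp only [sub_sub_cancel] at hj
      omega
    · subst hij
      simp only [sub_sub_cancel] at hi
      omega
    · subst hij
      rfl
  have hpairs := iIndepFun_curry (X := fun (i : ReflectionPairs n c) a => X (e ⟨i, a⟩))
    (hX.precomp he) fun i a => hm _
  exact hpairs.comp (fun _ p => φ (p true) (p false)) fun _ => by fun_prop

variable {n : ℕ} [NeZero n]

theorem sum_reflect_eq_two_mul_sum_reflectionPairs {R : Type*} [NonAssocSemiring R] (c : ZMod n)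
    {h : ZMod n → ZMod n → R} (hsymm : ∀ i j, h i j = h j i) (hdiag : ∀ i, h i i = 0) :
    ∑ i, h i (c - i) = 2 * ∑ i : ReflectionPairs n c, h i (c - i) := by
  have hswap : ∑ i with ¬ i.val < (c - i).val, h i (c - i)
      = ∑ i with i.val < (c - i).val, h i (c - i) :=
    calc ∑ i with ¬ i.val < (c - i).val, h i (c - i)
        = ∑ i with (c - i).val < i.val, h i (c - i) := by
          refine (Finset.sum_subset (fun i => ?_) fun i hle hnlt => ?_).symm
          · simp only [Finset.mem_filter, Finset.mem_univ, true_and]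
            omega
          · simp only [Finset.mem_filter, Finset.mem_univ, true_and] at hle hnlt
            rw [show c - i = i from ZMod.val_injective n (by omega), hdiag]
      _ = ∑ i with i.val < (c - i).val, h i (c - i) := by
          refine Finset.sum_nbij' (c - ·) (c - ·) ?_ ?_ ?_ ?_ ?_ <;> simp [hsymm]
  rw [← Finset.sum_filter_add_sum_filter_not Finset.univ fun i => i.val < (c - i).val, hswap,
    ← two_mul, Finset.sum_subtype (p := fun i => i.val < (c - i).val) _ (by simp)]

theorem sum_sum_eq_two_mul_sum_reflectionPairs {R : Type*} [NonAssocSemiring R]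
    {h : ZMod n → ZMod n → R} (hsymm : ∀ i j, h i j = h j i) (hdiag : ∀ i, h i i = 0) :
    ∑ i, ∑ j, h i j = 2 * ∑ c, ∑ i : ReflectionPairs n c, h i (c - i) := by
  calc ∑ i, ∑ j, h i j = ∑ i, ∑ c, h i (c - i) :=
        Finset.sum_congr rfl fun i _ => ((Equiv.subRight i).sum_comp (h i)).symm
    _ = ∑ c, ∑ i, h i (c - i) := Finset.sum_comm
    _ = 2 * ∑ c, ∑ i : ReflectionPairs n c, h i (c - i) := by
        rw [Finset.mul_sum]
        exact Finset.sum_congr rfl fun c _ =>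
          sum_reflect_eq_two_mul_sum_reflectionPairs c hsymm hdiag

end PairIndependence

section SampleVariance

variable {ι : Type*} [Fintype ι]

/-- The sample mean `n⁻¹ ∑ᵢ xᵢ` of a finite family. -/
noncomputable def sampleMean (x : ι → ℝ) : ℝ := (Fintype.card ι : ℝ)⁻¹ * ∑ i, x i

/-- The sample variance `(n - 1)⁻¹ ∑ᵢ (xᵢ - x̄)²` of a finite family, with Bessel's correction; it
is `0` when `n = 1`. -/
noncomputable def sampleVar (x : ι → ℝ) : ℝ :=
  ((Fintype.card ι : ℝ) - 1)⁻¹ * ∑ i, (x i - sampleMean x) ^ 2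

theorem card_mul_sampleMean [Nonempty ι] (x : ι → ℝ) :
    Fintype.card ι * sampleMean x = ∑ i, x i :=
  mul_inv_cancel_left₀ (Nat.cast_ne_zero.2 Fintype.card_ne_zero) _

theorem sum_sub_sampleMean_sq [Nonempty ι] (x : ι → ℝ) :
    ∑ i, (x i - sampleMean x) ^ 2 = ∑ i, x i ^ 2 - Fintype.card ι * sampleMean x ^ 2 := by
  simp only [sub_sq, Finset.sum_add_distrib, Finset.sum_sub_distrib, ← Finset.mul_sum,
    ← Finset.sum_mul, ← card_mul_sampleMean x, Finset.sum_const, Finset.card_univ, nsmul_eq_mul]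
  ring

theorem sampleVar_le [Nonempty ι] (x : ι → ℝ) :
    sampleVar x ≤ ((Fintype.card ι : ℝ) - 1)⁻¹ * ∑ i, x i ^ 2 := by
  have hn : (1 : ℝ) ≤ Fintype.card ι := Nat.one_le_cast.2 Fintype.card_pos
  rw [sampleVar, sum_sub_sampleMean_sq]
  exact mul_le_mul_of_nonneg_left (sub_le_self _ (by positivity)) (inv_nonneg.2 (sub_nonneg.2 hn))

theorem sampleMean_const [Nonempty ι] (c : ℝ) : sampleMean (fun _ : ι => c) = c := by
  rw [sampleMean, Finset.sum_const, Finset.card_univ, nsmul_eq_mul,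
    inv_mul_cancel_left₀ (Nat.cast_ne_zero.2 Fintype.card_ne_zero)]

theorem abs_sampleMean_sub_sampleMean_le [Nonempty ι] {x y : ι → ℝ} {b : ℝ}
    (h : ∀ i, |x i - y i| ≤ b) : |sampleMean x - sampleMean y| ≤ b := by
  calc |sampleMean x - sampleMean y| = (Fintype.card ι : ℝ)⁻¹ * |∑ i, (x i - y i)| := by
        rw [sampleMean, sampleMean, ← mul_sub, ← Finset.sum_sub_distrib, abs_mul,
          abs_of_nonneg (by positivity)]
    _ ≤ sampleMean fun _ : ι => b := by
        rw [sampleMean]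
        gcongr
        exact (Finset.abs_sum_le_sum_abs _ _).trans (Finset.sum_le_sum fun i _ => h i)
    _ = b := sampleMean_const b

theorem sum_sum_sub_sq [Nonempty ι] (x : ι → ℝ) :
    ∑ i, ∑ j, (x i - x j) ^ 2 = 2 * Fintype.card ι * ∑ i, (x i - sampleMean x) ^ 2 := by
  rw [sum_sub_sampleMean_sq]
  simp only [sub_sq, Finset.sum_add_distrib, Finset.sum_sub_distrib, ← Finset.mul_sum,
    ← Finset.sum_mul, ← card_mul_sampleMean x, Finset.sum_const, Finset.card_univ, nsmul_eq_mul]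
  ring

theorem sampleVar_eq_sum_sum [Nonempty ι] (x : ι → ℝ) :
    sampleVar x =
      (2 * Fintype.card ι * ((Fintype.card ι : ℝ) - 1))⁻¹ * ∑ i, ∑ j, (x i - x j) ^ 2 := by
  have hn : (Fintype.card ι : ℝ) ≠ 0 := Nat.cast_ne_zero.2 Fintype.card_ne_zero
  rw [sum_sum_sub_sq, sampleVar, mul_inv, mul_comm _ (_ - 1 : ℝ)⁻¹, mul_assoc,
    inv_mul_cancel_left₀ (mul_ne_zero two_ne_zero hn)]

theorem sampleMean_comp_equiv {κ : Type*} [Fintype κ] (e : κ ≃ ι) (x : ι → ℝ) :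
    sampleMean (x ∘ e) = sampleMean x := by
  simp only [sampleMean, Fintype.card_congr e, Function.comp_apply, e.sum_comp]

theorem sampleVar_comp_equiv {κ : Type*} [Fintype κ] (e : κ ≃ ι) (x : ι → ℝ) :
    sampleVar (x ∘ e) = sampleVar x := by
  simp only [sampleVar, sampleMean_comp_equiv, Fintype.card_congr e, Function.comp_apply,
    e.sum_comp fun i => (x i - sampleMean x) ^ 2]

theorem sampleVar_eq_sum_reflectionPairs {n : ℕ} [NeZero n] (x : ZMod n → ℝ) :
    sampleVar x = ∑ c, (n : ℝ)⁻¹ *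
      ∑ i : ReflectionPairs n c, ((n : ℝ) - 1)⁻¹ * (x i - x (c - i)) ^ 2 := by
  rw [sampleVar_eq_sum_sum, ZMod.card, sum_sum_eq_two_mul_sum_reflectionPairs
    (fun i j => sub_sq_comm (x i) (x j)) (fun i => by simp)]
  simp only [← Finset.mul_sum, mul_inv]
  ring

variable {Ω : Type*} [MeasurableSpace Ω] {μ : Measure Ω} {X : ι → Ω → ℝ} {M : ℝ}

section LowerTail

variable [IsProbabilityMeasure μ]

theorem hasSelfBoundingLowerMGF_sampleVar_zmod {n : ℕ} [NeZero n] {X : ZMod n → Ω → ℝ}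
    (hX : iIndepFun X μ) (hm : ∀ i, Measurable (X i))
    (hM : ∀ i j, ∀ᵐ ω ∂μ, |X i ω - X j ω| ≤ M) :
    HasSelfBoundingLowerMGF (fun ω => sampleVar fun i => X i ω) (M ^ 2 / (n - 1)) μ := by
  have hn : (1 : ℝ) ≤ n := Nat.one_le_cast.2 (NeZero.pos n)
  simp only [sampleVar_eq_sum_reflectionPairs]
  refine .convex_sum (fun c => .sum (fun i => .of_mem_Icc (by fun_prop) ?_) ?_ ?_)
    (fun _ => by positivity) ?_
  · filter_upwards [hM i (c - i)] with ω hω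
    refine ⟨mul_nonneg (inv_nonneg.2 (by linarith)) (sq_nonneg _), ?_⟩
    rw [div_eq_inv_mul]
    exact mul_le_mul_of_nonneg_left (sq_le_sq' (abs_le.1 hω).1 (abs_le.1 hω).2)
      (inv_nonneg.2 (by linarith))
  · exact iIndepFun_reflectionPairs hX hm c (φ := fun x y => ((n : ℝ) - 1)⁻¹ * (x - y) ^ 2)
      (by fun_prop)
  · fun_prop
  · simp

theorem hasSelfBoundingLowerMGF_sampleVar [Nonempty ι] (hX : iIndepFun X μ)
    (hm : ∀ i, Measurable (X i)) (hM : ∀ i j, ∀ᵐ ω ∂μ, |X i ω - X j ω| ≤ M) :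
    HasSelfBoundingLowerMGF (fun ω => sampleVar fun i => X i ω)
      (M ^ 2 / (Fintype.card ι - 1)) μ := by
  let e : ZMod (Fintype.card ι) ≃ ι := Fintype.equivOfCardEq (ZMod.card _)
  have h := hasSelfBoundingLowerMGF_sampleVar_zmod (hX.precomp e.injective) (fun i => hm (e i))
    fun i j => hM (e i) (e j)
  simp_rw [← sampleVar_comp_equiv e]
  exact h

end LowerTail

theorem variance_add_variance_le_integral_sub_sq [IsProbabilityMeasure μ] {Y Z : Ω → ℝ}
    (hYZ : IndepFun Y Z μ) (hY : MemLp Y 2 μ) (hZ : MemLp Z 2 μ) :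
    Var[Y; μ] + Var[Z; μ] ≤ ∫ ω, (Y ω - Z ω) ^ 2 ∂μ := by
  have h := variance_le_expectation_sq (hY.sub hZ).aestronglyMeasurable
  rwa [variance_sub hY hZ, hYZ.covariance_eq_zero hY hZ, mul_zero, sub_zero] at h

theorem sum_variance_le_sum_sum_integral_sub_sq [IsProbabilityMeasure μ] (hX : iIndepFun X μ)
    (h2 : ∀ i, MemLp (X i) 2 μ) :
    2 * ((Fintype.card ι : ℝ) - 1) * ∑ i, Var[X i; μ]
      ≤ ∑ i, ∑ j, ∫ ω, (X i ω - X j ω) ^ 2 ∂μ := by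
  classical
  calc 2 * ((Fintype.card ι : ℝ) - 1) * ∑ i, Var[X i; μ]
      = ∑ i, ∑ j, (Var[X i; μ] + Var[X j; μ] - if i = j then 2 * Var[X i; μ] else 0) := by
        simp only [Finset.sum_sub_distrib, Finset.sum_add_distrib, Finset.sum_const,
          Finset.sum_ite_eq, Finset.mem_univ, if_true, Finset.card_univ, nsmul_eq_mul,
          ← Finset.mul_sum]
        ring
    _ ≤ ∑ i, ∑ j, ∫ ω, (X i ω - X j ω) ^ 2 ∂μ := by
        refine Finset.sum_le_sum fun i _ => Finset.sum_le_sum fun j _ => ?_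
        split_ifs with hij
        · subst hij
          simp [two_mul]
        · rw [sub_zero]
          exact variance_add_variance_le_integral_sub_sq (hX.indepFun hij) (h2 i) (h2 j)

theorem sampleMean_variance_le_integral_sampleVar [IsProbabilityMeasure μ] [Nontrivial ι]
    (hX : iIndepFun X μ) (h2 : ∀ i, MemLp (X i) 2 μ) :
    sampleMean (fun i => Var[X i; μ]) ≤ ∫ ω, sampleVar (fun i => X i ω) ∂μ := by
  have hn : (1 : ℝ) < Fintype.card ι := Nat.one_lt_cast.2 Fintype.one_lt_card
  have hn' : 0 < (Fintype.card ι : ℝ) - 1 := sub_pos.2 hn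
  have hint (i j) : Integrable (fun ω => (X i ω - X j ω) ^ 2) μ :=
    ((h2 i).sub (h2 j)).integrable_sq
  simp_rw [sampleVar_eq_sum_sum]
  rw [integral_const_mul, integral_finsetSum _ fun i _ =>
    integrable_finsetSum _ fun j _ => hint i j,
    Finset.sum_congr rfl fun i _ => integral_finsetSum _ fun j _ => hint i j]
  calc sampleMean (fun i => Var[X i; μ])
      = (2 * Fintype.card ι * ((Fintype.card ι : ℝ) - 1))⁻¹ *
          (2 * ((Fintype.card ι : ℝ) - 1) * ∑ i, Var[X i; μ]) := by
        rw [sampleMean]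
        field_simp
    _ ≤ _ := by
        gcongr
        exact sum_variance_le_sum_sum_integral_sub_sq hX h2

theorem measureReal_abs_bernstein_le [IsProbabilityMeasure μ] (hX : iIndepFun X μ)
    (hm : ∀ i, Measurable (X i)) (hM : 0 < M) (hb : ∀ i, ∀ᵐ ω ∂μ, |X i ω - μ[X i]| ≤ M)
    {L : ℝ} (hL : 0 < L) :
    μ.real {ω | √(2 * (∑ i, Var[X i; μ]) * L) + M / 3 * L ≤ |∑ i, (X i ω - μ[X i])|}
      ≤ 2 * exp (-L) := by
  have hupper := measureReal_bernstein_le hX hm hM hb hL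
  have hlower := measureReal_bernstein_le (X := fun i ω => -X i ω) (μ := μ)
    (hX.comp (fun _ x => -x) fun _ => measurable_neg) (fun i => (hm i).neg) hM (fun i => by
      simpa only [integral_neg, ← neg_sub', abs_neg] using hb i) hL
  simp only [variance_fun_neg, integral_neg, ← neg_sub', Finset.sum_neg_distrib] at hlower
  rw [two_mul (exp _)]
  refine (measureReal_mono (fun ω hω => ?_) (measure_ne_top _ _)).trans
    ((measureReal_union_le _ _).trans (add_le_add hupper hlower))
  rwa [Set.mem_ofPred_eq, le_abs] at hω

theorem empirical_bernstein_of_sqrt_le {n v w M L d : ℝ} (hn : 1 < n) (hM : 0 ≤ M) (hL : 0 ≤ L)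
    (hv : √v ≤ √w + √(2 * (M ^ 2 / (n - 1)) * L))
    (hd : n * d ≤ √(2 * (n * v) * L) + M / 3 * L) :
    d ≤ √w * √(2 * L / n) + 7 * M * L / (3 * (n - 1)) := by
  have hn0 : 0 < n := by linarith
  have hn1 : 0 < n - 1 := by linarith
  have hσ : √(2 * L / n) ≤ √(2 * L / (n - 1)) := by
    gcongr
    linarith
  have hM' : √(2 * (M ^ 2 / (n - 1)) * L) = M * √(2 * L / (n - 1)) := by
    rw [show 2 * (M ^ 2 / (n - 1)) * L = M ^ 2 * (2 * L / (n - 1)) by ring,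
      sqrt_mul (sq_nonneg M), sqrt_sq hM]
  have hscale : √(2 * (n * v) * L) = n * (√v * √(2 * L / n)) := by
    rw [← sqrt_mul' _ (by positivity), show 2 * (n * v) * L = n ^ 2 * (v * (2 * L / n)) by
      field_simp, sqrt_mul (sq_nonneg n), sqrt_sq hn0.le]
  have hd' : d ≤ √v * √(2 * L / n) + M * L / (3 * n) := by
    refine le_of_mul_le_mul_left (hd.trans_eq ?_) hn0
    rw [hscale]
    field_simp
  calc d ≤ √v * √(2 * L / n) + M * L / (3 * n) := hd'
    _ ≤ (√w + M * √(2 * L / (n - 1))) * √(2 * L / n) + M * L / (3 * (n - 1)) := by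
        rw [← hM']
        gcongr
        linarith
    _ ≤ √w * √(2 * L / n) + M * (√(2 * L / (n - 1)) * √(2 * L / (n - 1)))
          + M * L / (3 * (n - 1)) := by
        rw [add_mul, mul_assoc]
        gcongr
    _ = √w * √(2 * L / n) + 7 * M * L / (3 * (n - 1)) := by
        rw [mul_self_sqrt (by positivity)]
        field_simp
        ring

theorem measureReal_empirical_bernstein_le [IsProbabilityMeasure μ] [Nontrivial ι]
    (hX : iIndepFun X μ) (hm : ∀ i, Measurable (X i)) {a b : ℝ} (hab : a < b)
    (hX_mem : ∀ i, ∀ᵐ ω ∂μ, X i ω ∈ Set.Icc a b) {L : ℝ} (hL : 0 < L) :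
    μ.real {ω | √(sampleVar fun i => X i ω) * √(2 * L / Fintype.card ι)
          + 7 * (b - a) * L / (3 * (Fintype.card ι - 1))
        < |sampleMean (fun i => X i ω) - sampleMean fun i => μ[X i]|} ≤ 3 * exp (-L) := by
  have hn : (1 : ℝ) < Fintype.card ι := Nat.one_lt_cast.2 Fintype.one_lt_card
  have hint (i) : Integrable (X i) μ := .of_mem_Icc a b (hm i).aemeasurable (hX_mem i)
  have hdev (i) : ∀ᵐ ω ∂μ, |X i ω - μ[X i]| ≤ b - a := by
    have hmean : μ[X i] ∈ Set.Icc a b :=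
      (convex_Icc a b).integral_mem isClosed_Icc (hX_mem i) (hint i)
    filter_upwards [hX_mem i] with ω hω
    exact Real.dist_le_of_mem_Icc hω hmean
  have hdiff (i j) : ∀ᵐ ω ∂μ, |X i ω - X j ω| ≤ b - a := by
    filter_upwards [hX_mem i, hX_mem j] with ω hi hj
    exact Real.dist_le_of_mem_Icc hi hj
  have h2 (i) : MemLp (X i) 2 μ := memLp_of_bounded (hX_mem i) (hm i).aestronglyMeasurable 2
  have hbernstein := measureReal_abs_bernstein_le hX hm (sub_pos.2 hab) hdev hL
  have hself := hasSelfBoundingLowerMGF_sampleVar hX hm hdiff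
  have hvar := hself.measureReal_sqrt_add_lt_sqrt_integral_le
    (div_pos (pow_pos (sub_pos.2 hab) 2) (sub_pos.2 hn)) hL.le
  rw [show 3 * exp (-L) = 2 * exp (-L) + exp (-L) by ring]
  refine (measureReal_mono (fun ω hω => ?_) (measure_ne_top _ _)).trans
    ((measureReal_union_le _ _).trans (add_le_add hbernstein hvar))
  by_contra hgood
  simp only [Set.mem_union, Set.mem_ofPred_eq, not_or, not_le, not_lt] at hgood hω
  obtain ⟨hsum, hvar⟩ := hgood
  refine hω.not_ge (empirical_bernstein_of_sqrt_le (v := sampleMean fun i => Var[X i; μ]) hn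
    (sub_nonneg.2 hab.le) hL.le ?_ ?_)
  · exact (sqrt_le_sqrt (sampleMean_variance_le_integral_sampleVar hX h2)).trans hvar
  · rw [← abs_of_pos (zero_lt_one.trans hn), ← abs_mul, abs_of_pos (zero_lt_one.trans hn), mul_sub,
      card_mul_sampleMean, card_mul_sampleMean, card_mul_sampleMean, ← Finset.sum_sub_distrib]
    exact hsum.le

end SampleVariance

/-! ### Single-elimination tournaments -/

section Tournament

variable {ι : Type*} {cmp : ι → ι → ι → Prop}

theorem exists_isRound (hcmp : ∀ a b, ∃ c, cmp a b c) :
    ∀ l : List ι, ∃ l', IsRound cmp l l' ∧ l'.length = (l.length + 1) / 2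
  | [] => ⟨[], .nil, by simp⟩
  | [a] => ⟨[a], .bye a, by simp⟩
  | a :: b :: l => by
    obtain ⟨c, hc⟩ := hcmp a b
    obtain ⟨l', hl', hlen⟩ := exists_isRound hcmp l
    refine ⟨c :: l', .pair hc hl', ?_⟩
    simp only [List.length_cons, hlen]
    omega

theorem exists_isRounds_singleton (hcmp : ∀ a b, ∃ c, cmp a b c) :
    ∀ (n : ℕ) (l : List ι), 0 < l.length → l.length ≤ 2 ^ n → ∃ r, IsRounds cmp n l [r]
  | 0, l, hpos, hlen => by
    obtain ⟨r, rfl⟩ := List.length_eq_one_iff.1 (show l.length = 1 by omega)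
    exact ⟨r, .zero _⟩
  | n + 1, l, hpos, hlen => by
    obtain ⟨l', hround, hlen'⟩ := exists_isRound hcmp l
    obtain ⟨r, hr⟩ := exists_isRounds_singleton hcmp n l' (by omega) (by omega)
    exact ⟨r, .succ (.refl l) hround hr⟩

variable {α : Type*} [AddCommMonoid α] [PartialOrder α] [IsOrderedAddMonoid α] {v : ι → α} {e : α}

theorem IsRound.exists_le (he : 0 ≤ e)
    (hcmp : ∀ a b c, cmp a b c → v c ≤ v a + e ∧ v c ≤ v b + e) {l l' : List ι}
    (hround : IsRound cmp l l') : ∀ x ∈ l, ∃ y ∈ l', v y ≤ v x + e := by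
  induction hround with
  | nil => simp
  | bye a => simpa using le_add_of_nonneg_right he
  | @pair a b c l l' hc _ ih =>
    intro x hx
    rcases List.mem_cons.1 hx with rfl | hx
    · exact ⟨c, List.mem_cons_self, (hcmp _ _ _ hc).1⟩
    rcases List.mem_cons.1 hx with rfl | hx
    · exact ⟨c, List.mem_cons_self, (hcmp _ _ _ hc).2⟩
    · obtain ⟨y, hy, hyx⟩ := ih x hx
      exact ⟨y, List.mem_cons_of_mem _ hy, hyx⟩

theorem IsRounds.exists_le (he : 0 ≤ e)
    (hcmp : ∀ a b c, cmp a b c → v c ≤ v a + e ∧ v c ≤ v b + e) {n : ℕ} {l l' : List ι}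
    (hrounds : IsRounds cmp n l l') : ∀ x ∈ l, ∃ y ∈ l', v y ≤ v x + n • e := by
  induction hrounds with
  | zero l => exact fun x hx => ⟨x, hx, by simp⟩
  | @succ n _ _ _ _ hperm hround _ ih =>
    intro x hx
    obtain ⟨y, hy, hyx⟩ := hround.exists_le he hcmp x (hperm.mem_iff.1 hx)
    obtain ⟨w, hw, hwy⟩ := ih y hy
    refine ⟨w, hw, hwy.trans ?_⟩
    rw [succ_nsmul', ← add_assoc]
    gcongr

end Tournament

/-! ### Adaptive choice of the window -/

section Window

variable {B : ℕ → ℕ} {u : (j : ℕ) → Fin (B j) → ℝ} {M δ' : ℝ} {t k : ℕ}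

theorem window_subset_Icc (t k : ℕ) : window t k ⊆ Finset.Icc 1 t :=
  Finset.Icc_subset_Icc (by omega) le_rfl

theorem window_mono (t : ℕ) : Monotone (window t) :=
  fun _ _ h => Finset.Icc_subset_Icc (by omega) le_rfl

theorem self_mem_window (hk : k ∈ Finset.Icc 1 t) : t ∈ window t k := by
  rw [Finset.mem_Icc] at hk
  exact Finset.mem_Icc.2 ⟨by omega, le_rfl⟩

/-- The index set of the observations `u j i` with `j` in the window `window t k`. -/
abbrev WindowIndex (B : ℕ → ℕ) (t k : ℕ) : Type := (j : window t k) × Fin (B j)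

theorem nonempty_windowIndex (hB : 1 ≤ B t) (hk : k ∈ Finset.Icc 1 t) :
    Nonempty (WindowIndex B t k) :=
  ⟨⟨t, self_mem_window hk⟩, ⟨0, hB⟩⟩

theorem card_windowIndex (B : ℕ → ℕ) (t k : ℕ) :
    Fintype.card (WindowIndex B t k) = winSize B t k := by
  simp only [winSize, Fintype.card_sigma, Fintype.card_fin, Finset.sum_coe_sort (window t k) B]

theorem one_le_winSize (hB : 1 ≤ B t) (hk : k ∈ Finset.Icc 1 t) : 1 ≤ winSize B t k :=
  card_windowIndex B t k ▸ Fintype.card_pos_iff.2 (nonempty_windowIndex hB hk)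

theorem sum_windowIndex {R : Type*} [AddCommMonoid R] (g : (j : ℕ) → Fin (B j) → R) (t k : ℕ) :
    ∑ s : WindowIndex B t k, g s.1 s.2 = ∑ j ∈ window t k, ∑ i, g j i := by
  rw [Fintype.sum_sigma, ← Finset.sum_coe_sort (window t k)]

theorem sampleMean_windowIndex (u : (j : ℕ) → Fin (B j) → ℝ) (t k : ℕ) :
    sampleMean (fun s : WindowIndex B t k => u s.1 s.2) = winMean u t k := by
  rw [sampleMean, winMean, card_windowIndex, sum_windowIndex]

theorem sampleVar_windowIndex (u : (j : ℕ) → Fin (B j) → ℝ) (t k : ℕ) :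
    sampleVar (fun s : WindowIndex B t k => u s.1 s.2) = winVar u t k := by
  rw [sampleVar, winVar, card_windowIndex, sampleMean_windowIndex,
    sum_windowIndex fun j i => (u j i - winMean u t k) ^ 2]

theorem winVar_le (hB : 1 ≤ B t) (hk : k ∈ Finset.Icc 1 t) :
    winVar u t k ≤ ((winSize B t k : ℝ) - 1)⁻¹ * ∑ j ∈ window t k, ∑ i, u j i ^ 2 := by
  have := nonempty_windowIndex hB hk
  rw [← sampleVar_windowIndex, ← sum_windowIndex fun j i => u j i ^ 2, ← card_windowIndex]
  exact sampleVar_le _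

theorem abs_winMean_sub_le (hB : 1 ≤ B t) (hk : k ∈ Finset.Icc 1 t) {D : ℕ → ℝ} {Δ b : ℝ}
    (hD : ∀ j ∈ window t k, |D j - Δ| ≤ b) :
    |winMean (fun j (_ : Fin (B j)) => D j) t k - Δ| ≤ b := by
  have := nonempty_windowIndex hB hk
  rw [← sampleMean_windowIndex, ← sampleMean_const (ι := WindowIndex B t k) Δ]
  exact abs_sampleMean_sub_sampleMean_le fun s => hD s.1 s.1.2

theorem psiHat_nonneg (hM : 0 ≤ M) (hL : 0 ≤ log (2 / δ')) (hk : 1 ≤ winSize B t k) :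
    0 ≤ psiHat u M δ' t k := by
  have hn : (0 : ℝ) ≤ (winSize B t k : ℝ) - 1 := sub_nonneg.2 (Nat.one_le_cast.2 hk)
  unfold psiHat
  split_ifs <;> positivity

theorem phiHat_nonneg : 0 ≤ phiHat u M δ' t k :=
  Real.iSup_nonneg fun _ => le_max_right _ _

theorem abs_winMean_sub_le_phiHat {i : ℕ} (hi : i ∈ Finset.Icc 1 k) :
    |winMean u t k - winMean u t i| - (psiHat u M δ' t k + psiHat u M δ' t i)
      ≤ phiHat u M δ' t k :=
  (le_max_left _ _).trans (le_ciSup (f := fun i : Finset.Icc 1 k =>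
    max (|winMean u t k - winMean u t i| - (psiHat u M δ' t k + psiHat u M δ' t i)) 0)
    (Set.finite_range _).bddAbove ⟨i, hi⟩)

theorem exists_isSelectedWindow (u : (j : ℕ) → Fin (B j) → ℝ) (M δ' : ℝ) (ht : 1 ≤ t) :
    ∃ k, IsSelectedWindow u M δ' t k :=
  Finset.exists_min_image (Finset.Icc 1 t) _ ⟨1, Finset.mem_Icc.2 ⟨le_rfl, ht⟩⟩

theorem phiHat_le_two_mul {Δ : ℝ} {b : ℕ → ℝ} (hb : MonotoneOn b (Finset.Icc 1 t))
    (hdev : ∀ k ∈ Finset.Icc 1 t, |winMean u t k - Δ| ≤ psiHat u M δ' t k + b k)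
    (hk : k ∈ Finset.Icc 1 t) (hbk : 0 ≤ b k) : phiHat u M δ' t k ≤ 2 * b k := by
  refine Real.iSup_le (fun ⟨i, hi⟩ => max_le ?_ (by positivity)) (by positivity)
  have hik : i ≤ k := (Finset.mem_Icc.1 hi).2
  have hit : i ∈ Finset.Icc 1 t := Finset.Icc_subset_Icc_right (Finset.mem_Icc.1 hk).2 hi
  have htri := abs_sub_le (winMean u t k) Δ (winMean u t i)
  rw [abs_sub_comm Δ] at htri
  linarith [hdev k hk, hdev i hit, hb hit hk hik]

/-- If `s ≥ k`, then `φ̂(s)` controls the distance of the two window means; if `s < k`, the bias of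
the window `s` is at most that of `k`. -/
theorem IsSelectedWindow.abs_winMean_sub_le {s : ℕ} (hs : IsSelectedWindow u M δ' t s)
    {Δ : ℝ} {b : ℕ → ℝ} (hb : MonotoneOn b (Finset.Icc 1 t)) (hb0 : ∀ k, 0 ≤ b k)
    (hψ : ∀ k ∈ Finset.Icc 1 t, 0 ≤ psiHat u M δ' t k)
    (hdev : ∀ k ∈ Finset.Icc 1 t, |winMean u t k - Δ| ≤ psiHat u M δ' t k + b k)
    (hk : k ∈ Finset.Icc 1 t) :
    |winMean u t s - Δ| ≤ 3 * b k + 3 * psiHat u M δ' t k := by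
  obtain ⟨hst, hmin⟩ := hs
  have hφ := phiHat_le_two_mul hb hdev hk (hb0 k)
  have hle := hmin k hk
  rcases le_or_gt k s with hks | hsk
  · have hdist := abs_winMean_sub_le_phiHat (u := u) (M := M) (δ' := δ') (t := t)
      (Finset.mem_Icc.2 ⟨(Finset.mem_Icc.1 hk).1, hks⟩)
    linarith [abs_sub_le (winMean u t s) (winMean u t k) Δ, hdev k hk, hb0 k]
  · linarith [hdev s hst, hb hst hk hsk.le, hψ k hk, hb0 k,
      phiHat_nonneg (u := u) (M := M) (δ' := δ') (t := t) (k := s)]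

theorem sqrt_winVar_le (hB : 1 ≤ B t) (hk : k ∈ Finset.Icc 1 t) (hk2 : winSize B t k ≠ 1)
    {K v L : ℝ} (hK : 0 ≤ K) (hv : 0 ≤ v) (hL : 0 ≤ L)
    (hu : ∑ j ∈ window t k, ∑ i, u j i ^ 2 ≤ 2 * (winSize B t k * v ^ 2) + K ^ 2 * L) :
    √(winVar u t k) ≤ 2 * v + 3 / 2 * (K * √(L / winSize B t k)) := by
  have hwin := winVar_le (u := u) hB hk
  have hn : (2 : ℝ) ≤ winSize B t k := by
    exact_mod_cast (one_le_winSize hB hk).lt_of_ne' hk2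
  set n := (winSize B t k : ℝ)
  have hinv : (n - 1)⁻¹ ≤ 2 / n := by
    rw [inv_eq_one_div, div_le_div_iff₀ (by linarith) (by linarith)]
    linarith
  have hσ : √(L / n) ^ 2 = L / n := sq_sqrt (by positivity)
  rw [sqrt_le_left (by positivity)]
  calc winVar u t k ≤ 2 / n * (2 * (n * v ^ 2) + K ^ 2 * L) := by
        refine hwin.trans ?_
        gcongr
    _ = 4 * v ^ 2 + 2 * (K ^ 2 * √(L / n) ^ 2) := by
        rw [hσ]
        field_simp
        ring
    _ ≤ (2 * v + 3 / 2 * (K * √(L / n))) ^ 2 := by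
        linarith [mul_nonneg hv (mul_nonneg hK (sqrt_nonneg (L / n))),
          sq_nonneg (K * √(L / n)), mul_pow K (√(L / n)) 2]

theorem psiHat_le (hB : 1 ≤ B t) (hk : k ∈ Finset.Icc 1 t) {K v : ℝ} (hK : 0 ≤ K) (hv : 0 ≤ v)
    (hL : 1 ≤ log (2 / δ'))
    (hu : ∑ j ∈ window t k, ∑ i, u j i ^ 2
      ≤ 2 * (winSize B t k * v ^ 2) + K ^ 2 * log (2 / δ')) :
    psiHat u (2 * K) δ' t k ≤ 3 * v * √(log (2 / δ') / winSize B t k)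
      + 13 * K * √(log (2 / δ') / winSize B t k) ^ 2 := by
  set L := log (2 / δ')
  unfold psiHat
  split_ifs with hk1
  · rw [hk1, Nat.cast_one, div_one, sq_sqrt (by linarith)]
    have : K * 1 ≤ K * L := by gcongr
    linarith [mul_nonneg hv (sqrt_nonneg L)]
  · have hV := sqrt_winVar_le hB hk hk1 hK hv (zero_le_one.trans hL) hu
    have hn : (2 : ℝ) ≤ winSize B t k := by
      exact_mod_cast (one_le_winSize hB hk).lt_of_ne' hk1
    set n := (winSize B t k : ℝ)
    set σ := √(L / n)
    have hσ : σ ^ 2 = L / n := sq_sqrt (by positivity)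
    have hσ2 : √(2 * L / n) ≤ 3 / 2 * σ := by
      rw [mul_div_assoc, sqrt_mul zero_le_two]
      gcongr
      exact (sqrt_le_left (by norm_num)).2 (by norm_num)
    have hlin : 8 * (2 * K) * L / (3 * (n - 1)) ≤ 32 / 3 * (K * σ ^ 2) := by
      rw [hσ, div_le_iff₀ (by linarith)]
      have : K * n ≤ K * (2 * (n - 1)) := by
        gcongr
        linarith
      field_simp
      linarith
    calc √(winVar u t k) * √(2 * L / n) + 8 * (2 * K) * L / (3 * (n - 1))
        ≤ (2 * v + 3 / 2 * (K * σ)) * (3 / 2 * σ) + 32 / 3 * (K * σ ^ 2) := by gcongr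
      _ ≤ 3 * v * σ + 13 * K * σ ^ 2 := by linarith [mul_nonneg hK (sq_nonneg σ)]

end Window

section WindowConcentration

variable {B : ℕ → ℕ} {t k : ℕ} {K v δ' : ℝ}

/-- The event on which the window selection succeeds: over every window, the mean of the data `u` is
`psiHat`-close to the average of the period means `D j`, and the squares of `u` are controlled by
their second moment, which is at most `v ^ 2`. The data are bounded by `K`, hence lie in an interval
of length `2 * K`. -/
structure IsWellConcentrated (u : (j : ℕ) → Fin (B j) → ℝ) (D : ℕ → ℝ) (K v δ' : ℝ) (t : ℕ) :
    Prop where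
  abs_winMean_sub_winMean_le : ∀ k ∈ Finset.Icc 1 t,
    |winMean u t k - winMean (fun j (_ : Fin (B j)) => D j) t k| ≤ psiHat u (2 * K) δ' t k
  sum_sq_le : ∀ k ∈ Finset.Icc 1 t, ∑ j ∈ window t k, ∑ i, u j i ^ 2
    ≤ 2 * (winSize B t k * v ^ 2) + K ^ 2 * log (2 / δ')

theorem IsWellConcentrated.abs_winMean_selected_sub_le {u : (j : ℕ) → Fin (B j) → ℝ} {D : ℕ → ℝ}
    (hu : IsWellConcentrated u D K v δ' t) (hB : 1 ≤ B t) (hK : 0 ≤ K) (hv : 0 ≤ v)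
    (hL : 1 ≤ log (2 / δ')) {s : ℕ} (hs : IsSelectedWindow u (2 * K) δ' t s) {Δ : ℝ} {b : ℕ → ℝ}
    (hb : MonotoneOn b (Finset.Icc 1 t)) (hb0 : ∀ k, 0 ≤ b k)
    (hD : ∀ k ∈ Finset.Icc 1 t, ∀ j ∈ window t k, |D j - Δ| ≤ b k) (hk : k ∈ Finset.Icc 1 t) :
    |winMean u t s - Δ| ≤ 3 * b k + 9 * v * √(log (2 / δ') / winSize B t k)
      + 39 * K * √(log (2 / δ') / winSize B t k) ^ 2 := by
  have hdev (k) (hk : k ∈ Finset.Icc 1 t) :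
      |winMean u t k - Δ| ≤ psiHat u (2 * K) δ' t k + b k :=
    (abs_sub_le _ _ _).trans
      (add_le_add (hu.abs_winMean_sub_winMean_le k hk) (abs_winMean_sub_le hB hk (hD k hk)))
  have hψ (k) (hk : k ∈ Finset.Icc 1 t) : 0 ≤ psiHat u (2 * K) δ' t k :=
    psiHat_nonneg (by positivity) (zero_le_one.trans hL) (one_le_winSize hB hk)
  linarith [hs.abs_winMean_sub_le hb hb0 hψ hdev hk,
    psiHat_le hB hk hK hv hL (hu.sum_sq_le k hk)]

variable {Ω : Type*} [MeasurableSpace Ω] {μ : Measure Ω}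
  {U : (j : ℕ) → Fin (B j) → Ω → ℝ} {D : ℕ → ℝ}

theorem iIndepFun_windowIndex
    (hU : iIndepFun (fun s : (j : Finset.Icc 1 t) × Fin (B j) => U s.1 s.2) μ) (k : ℕ) :
    iIndepFun (fun s : WindowIndex B t k => U s.1 s.2) μ := by
  let e : WindowIndex B t k → (j : Finset.Icc 1 t) × Fin (B j) :=
    Sigma.map (Set.inclusion (window_subset_Icc t k)) fun _ => id
  have he : e.Injective :=
    (Set.inclusion_injective (window_subset_Icc t k)).sigma_map fun _ => Function.injective_id
  exact hU.precomp he

variable [IsProbabilityMeasure μ]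

theorem measureReal_psiHat_lt_abs_winMean_sub_le (hB : 1 ≤ B t) (hk : k ∈ Finset.Icc 1 t)
    (hU : iIndepFun (fun s : WindowIndex B t k => U s.1 s.2) μ)
    (hm : ∀ j ∈ window t k, ∀ i, Measurable (U j i)) (hK : 0 < K)
    (hUK : ∀ j ∈ window t k, ∀ i, ∀ᵐ ω ∂μ, |U j i ω| ≤ K)
    (hD : ∀ j ∈ window t k, ∀ i, μ[U j i] = D j) (hL : 0 < log (2 / δ')) :
    μ.real {ω | psiHat (fun j i => U j i ω) (2 * K) δ' t k
        < |winMean (fun j i => U j i ω) t k - winMean (fun j (_ : Fin (B j)) => D j) t k|}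
      ≤ 3 * exp (-log (2 / δ')) := by
  have := nonempty_windowIndex hB hk
  have hmem (s : WindowIndex B t k) : ∀ᵐ ω ∂μ, U s.1 s.2 ω ∈ Set.Icc (-K) K :=
    (hUK _ s.1.2 s.2).mono fun _ => abs_le.1
  have hmean (s : WindowIndex B t k) : μ[U s.1 s.2] = D s.1 := hD _ s.1.2 s.2
  by_cases hk1 : winSize B t k = 1
  · have hdiff : ∀ᵐ ω ∂μ, ∀ s : WindowIndex B t k, |U s.1 s.2 ω - D s.1| ≤ 2 * K := by
      refine ae_all_iff.2 fun s => ?_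
      have hDmem : μ[U s.1 s.2] ∈ Set.Icc (-K) K := (convex_Icc (-K) K).integral_mem isClosed_Icc
        (hmem s) (.of_mem_Icc (-K) K (hm _ s.1.2 s.2).aemeasurable (hmem s))
      filter_upwards [hmem s] with ω hω
      rw [← hmean s, show 2 * K = K - -K by ring]
      exact Real.dist_le_of_mem_Icc hω hDmem
    refine ((measureReal_eq_zero_iff (measure_ne_top _ _)).2
      (measure_mono_null ?_ hdiff)).trans_le (by positivity)
    intro ω hω hall
    rw [Set.mem_ofPred_eq, psiHat, if_pos hk1, ← sampleMean_windowIndex,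
      ← sampleMean_windowIndex] at hω
    exact hω.not_ge (abs_sampleMean_sub_sampleMean_le hall)
  · have : Nontrivial (WindowIndex B t k) := by
      rw [← Fintype.one_lt_card_iff_nontrivial, card_windowIndex]
      exact (one_le_winSize hB hk).lt_of_ne' hk1
    refine (measureReal_mono (fun ω hω => ?_) (measure_ne_top _ _)).trans
      (measureReal_empirical_bernstein_le hU (fun s => hm _ s.1.2 s.2) (neg_lt_self hK) hmem hL)
    have hn : (1 : ℝ) < winSize B t k := Nat.one_lt_cast.2 ((one_le_winSize hB hk).lt_of_ne' hk1)
    simp only [Set.mem_ofPred_eq, psiHat, if_neg hk1, hmean, card_windowIndex] at hω ⊢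
    rw [sampleVar_windowIndex fun j i => U j i ω, sampleMean_windowIndex fun j i => U j i ω,
      sampleMean_windowIndex fun j (_ : Fin (B j)) => D j]
    refine lt_of_le_of_lt ?_ hω
    gcongr
    · linarith
    · linarith
    · linarith

theorem measureReal_lt_sum_sq_le
    (hU : iIndepFun (fun s : WindowIndex B t k => U s.1 s.2) μ)
    (hm : ∀ j ∈ window t k, ∀ i, Measurable (U j i)) (hK : 0 < K)
    (hUK : ∀ j ∈ window t k, ∀ i, ∀ᵐ ω ∂μ, |U j i ω| ≤ K)
    (hUv : ∀ j ∈ window t k, ∀ i, ∫ ω, U j i ω ^ 2 ∂μ ≤ v ^ 2) (L : ℝ) :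
    μ.real {ω | 2 * (winSize B t k * v ^ 2) + K ^ 2 * L < ∑ j ∈ window t k, ∑ i, U j i ω ^ 2}
      ≤ exp (-L) := by
  refine (measureReal_mono (fun ω hω => ?_) (measure_ne_top _ _)).trans
    (measureReal_sum_ge_two_mul_integral_add_le
      (hU.comp (fun _ x => x ^ 2) fun _ => measurable_id.pow_const 2)
      (fun s => (hm _ s.1.2 s.2).pow_const 2) (pow_pos hK 2) (fun s => ?_) L)
  · have hsum : ∑ s : WindowIndex B t k, ∫ ω, U s.1 s.2 ω ^ 2 ∂μ ≤ winSize B t k * v ^ 2 := by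
      refine (Finset.sum_le_card_nsmul _ _ _ fun s _ => hUv _ s.1.2 s.2).trans_eq ?_
      rw [Finset.card_univ, card_windowIndex, nsmul_eq_mul]
    rw [Set.mem_ofPred_eq, ← sum_windowIndex fun j i => U j i ω ^ 2] at hω
    refine le_trans ?_ hω.le
    gcongr
    exact hsum
  · filter_upwards [hUK _ s.1.2 s.2] with ω hω
    exact ⟨sq_nonneg _, sq_le_sq' (abs_le.1 hω).1 (abs_le.1 hω).2⟩

theorem measureReal_not_isWellConcentrated_le (hB : 1 ≤ B t)
    (hU : iIndepFun (fun s : (j : Finset.Icc 1 t) × Fin (B j) => U s.1 s.2) μ)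
    (hm : ∀ j ∈ Finset.Icc 1 t, ∀ i, Measurable (U j i)) (hK : 0 < K)
    (hUK : ∀ j ∈ Finset.Icc 1 t, ∀ i, ∀ᵐ ω ∂μ, |U j i ω| ≤ K)
    (hD : ∀ j ∈ Finset.Icc 1 t, ∀ i, μ[U j i] = D j)
    (hUv : ∀ j ∈ Finset.Icc 1 t, ∀ i, ∫ ω, U j i ω ^ 2 ∂μ ≤ v ^ 2)
    (hδ' : 0 < δ') (hL : 0 < log (2 / δ')) :
    μ.real {ω | ¬ IsWellConcentrated (fun j i => U j i ω) D K v δ' t} ≤ 2 * t * δ' := by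
  let badMean (k : ℕ) : Set Ω := {ω | psiHat (fun j i => U j i ω) (2 * K) δ' t k
    < |winMean (fun j i => U j i ω) t k - winMean (fun j (_ : Fin (B j)) => D j) t k|}
  let badSq (k : ℕ) : Set Ω := {ω | 2 * (winSize B t k * v ^ 2) + K ^ 2 * log (2 / δ')
    < ∑ j ∈ window t k, ∑ i, U j i ω ^ 2}
  have hbad (k) (hk : k ∈ Finset.Icc 1 t) : μ.real (badMean k ∪ badSq k) ≤ 2 * δ' := by
    have hsub {j} (hj : j ∈ window t k) : j ∈ Finset.Icc 1 t := window_subset_Icc t k hj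
    have hmean := measureReal_psiHat_lt_abs_winMean_sub_le hB hk (iIndepFun_windowIndex hU k)
      (fun j hj => hm j (hsub hj)) hK (fun j hj => hUK j (hsub hj)) (fun j hj => hD j (hsub hj)) hL
    have hsq := measureReal_lt_sum_sq_le (iIndepFun_windowIndex hU k) (fun j hj => hm j (hsub hj))
      hK (fun j hj => hUK j (hsub hj)) (fun j hj => hUv j (hsub hj)) (log (2 / δ'))
    have hexp : exp (-log (2 / δ')) = δ' / 2 := by
      rw [exp_neg, exp_log (by positivity), inv_div]
    linarith [measureReal_union_le (μ := μ) (badMean k) (badSq k)]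
  calc μ.real {ω | ¬ IsWellConcentrated (fun j i => U j i ω) D K v δ' t}
      ≤ μ.real (⋃ k ∈ Finset.Icc 1 t, (badMean k ∪ badSq k)) := by
        refine measureReal_mono (fun ω hω => ?_) (measure_ne_top _ _)
        contrapose! hω
        simp only [Set.mem_iUnion, not_exists, Set.mem_union, not_or] at hω
        exact not_not.2 ⟨fun k hk => not_lt.1 (hω k hk).1, fun k hk => not_lt.1 (hω k hk).2⟩
    _ ≤ ∑ k ∈ Finset.Icc 1 t, μ.real (badMean k ∪ badSq k) :=
        measureReal_biUnion_finset_le _ _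
    _ ≤ 2 * t * δ' := by
        refine (Finset.sum_le_card_nsmul _ _ _ hbad).trans_eq ?_
        rw [Nat.card_Icc, Nat.add_sub_cancel, nsmul_eq_mul]
        ring

end WindowConcentration

/-! ### The square loss and the regression function -/

section L2norm

variable {X : Type*} [MeasurableSpace X] {μ : Measure X} {f g h : X → ℝ}

theorem l2norm_nonneg (μ : Measure X) (h : X → ℝ) : 0 ≤ l2norm μ h :=
  sqrt_nonneg _

theorem l2norm_sq (μ : Measure X) (h : X → ℝ) : l2norm μ h ^ 2 = ∫ x, h x ^ 2 ∂μ := by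
  simp_rw [l2norm, ← pow_two]
  exact sq_sqrt (integral_nonneg fun x => sq_nonneg (h x))

theorem inner_toLp_two (hg : MemLp g 2 μ) (hh : MemLp h 2 μ) :
    inner ℝ (hg.toLp g) (hh.toLp h) = ∫ x, g x * h x ∂μ := by
  rw [L2.inner_def]
  refine integral_congr_ae ?_
  filter_upwards [hg.coeFn_toLp, hh.coeFn_toLp] with x hgx hhx
  rw [hgx, hhx, RCLike.inner_apply, conj_trivial, mul_comm]

theorem norm_toLp_two (hh : MemLp h 2 μ) : ‖hh.toLp h‖ = l2norm μ h := by
  rw [l2norm, ← inner_toLp_two hh hh, real_inner_self_eq_norm_sq, sqrt_sq (norm_nonneg _)]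

theorem abs_integral_mul_le_l2norm_mul_l2norm (hg : MemLp g 2 μ) (hh : MemLp h 2 μ) :
    |∫ x, g x * h x ∂μ| ≤ l2norm μ g * l2norm μ h := by
  rw [← inner_toLp_two hg hh, ← norm_toLp_two hg, ← norm_toLp_two hh]
  exact abs_real_inner_le_norm _ _

theorem l2norm_sub_le (hf : MemLp f 2 μ) (hg : MemLp g 2 μ) (hh : MemLp h 2 μ) :
    l2norm μ (f - g) ≤ l2norm μ (f - h) + l2norm μ (g - h) := by
  rw [← norm_toLp_two (hf.sub hg), ← norm_toLp_two (hf.sub hh), ← norm_toLp_two (hg.sub hh),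
    MemLp.toLp_sub hf hg, MemLp.toLp_sub hf hh, MemLp.toLp_sub hg hh, norm_sub_rev (hg.toLp g)]
  exact norm_sub_le_norm_sub_add_norm_sub _ _ _

end L2norm

theorem abs_sqLoss_sub_le {X : Type*} {f g : X → ℝ} {M₀ : ℝ} (hf : ∀ x, |f x| ≤ M₀)
    (hg : ∀ x, |g x| ≤ M₀) {w : X × ℝ} (hw : |w.2| ≤ M₀) :
    |sqLoss f w - sqLoss g w| ≤ 4 * M₀ ^ 2 := by
  have hmem {h : X → ℝ} (hh : ∀ x, |h x| ≤ M₀) : sqLoss h w ∈ Set.Icc 0 (4 * M₀ ^ 2) := by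
    refine ⟨sq_nonneg _, ?_⟩
    rw [show 4 * M₀ ^ 2 = (2 * M₀) ^ 2 by ring, sqLoss, sq_le_sq, two_mul]
    exact (abs_sub _ _).trans ((add_le_add (hh _) hw).trans (le_abs_self _))
  simpa using abs_sub_le_of_le_of_le (hmem hf).1 (hmem hf).2 (hmem hg).1 (hmem hg).2

section Regression

variable {X : Type*} [MeasurableSpace X] {P : Measure (X × ℝ)} [IsFiniteMeasure P]

theorem aestronglyMeasurable_regFun (P : Measure (X × ℝ)) [IsFiniteMeasure P] :
    AEStronglyMeasurable (regFun P) P.fst :=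
  (measurable_snd.aestronglyMeasurable (μ := P)).integral_condKernel

theorem memLp_regFun (hy : MemLp Prod.snd 2 P) : MemLp (regFun P) 2 P.fst := by
  rw [memLp_two_iff_integrable_sq (aestronglyMeasurable_regFun P)]
  refine hy.integrable_sq.integral_condKernel.mono' ((aestronglyMeasurable_regFun P).pow 2) ?_
  filter_upwards [hy.integrable_sq.condKernel_ae] with x hx
  have hyx : MemLp (fun y : ℝ => y) 2 (P.condKernel x) :=
    (memLp_two_iff_integrable_sq measurable_id.aestronglyMeasurable).2 hx
  rw [norm_eq_abs, abs_of_nonneg (sq_nonneg _), ← sub_nonneg]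
  exact (variance_nonneg _ _).trans_eq (variance_eq_sub hyx)

theorem integral_mul_snd {h : X → ℝ} (hi : Integrable (fun w : X × ℝ => h w.1 * w.2) P) :
    ∫ w, h w.1 * w.2 ∂P = ∫ x, h x * regFun P x ∂P.fst := by
  rw [← Measure.integral_condKernel hi]
  congr with x
  exact integral_const_mul (h x) fun y => y

variable {f g : X → ℝ}

theorem integral_sqLoss_sub (hf : MemLp f 2 P.fst) (hg : MemLp g 2 P.fst)
    (hy : MemLp Prod.snd 2 P) :
    ∫ w, (sqLoss f w - sqLoss g w) ∂P
      = ∫ x, (f - g) x * (f + g) x ∂P.fst - 2 * ∫ x, (f - g) x * regFun P x ∂P.fst := by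
  have hfst : MeasurePreserving Prod.fst P P.fst := ⟨measurable_fst, rfl⟩
  have hfg := (hf.sub hg).comp_measurePreserving hfst
  have hsum : Integrable (fun w : X × ℝ => (f - g) w.1 * (f + g) w.1) P :=
    hfg.integrable_mul ((hf.add hg).comp_measurePreserving hfst)
  have hsnd : Integrable (fun w : X × ℝ => (f - g) w.1 * w.2) P := hfg.integrable_mul hy
  calc ∫ w, (sqLoss f w - sqLoss g w) ∂P
      = ∫ w, ((f - g) w.1 * (f + g) w.1 - 2 * ((f - g) w.1 * w.2)) ∂P := by
        congr with w
        simp only [sqLoss, Pi.sub_apply, Pi.add_apply]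
        ring
    _ = ∫ w, (f - g) w.1 * (f + g) w.1 ∂P - 2 * ∫ w, (f - g) w.1 * w.2 ∂P := by
        rw [integral_sub hsum (hsnd.const_mul 2), integral_const_mul]
    _ = _ := by
        rw [integral_mul_snd hsnd, Measure.fst,
          integral_map (f := fun x => (f - g) x * (f + g) x) measurable_fst.aemeasurable
          ((hf.sub hg).integrable_mul (hf.add hg)).aestronglyMeasurable]

theorem integral_sqLoss_sub_eq_l2norm (hf : MemLp f 2 P.fst) (hg : MemLp g 2 P.fst)
    (hy : MemLp Prod.snd 2 P) :
    ∫ w, (sqLoss f w - sqLoss g w) ∂P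
      = l2norm P.fst (f - regFun P) ^ 2 - l2norm P.fst (g - regFun P) ^ 2 := by
  have hr := memLp_regFun hy
  have hsum : Integrable (fun x => (f - g) x * (f + g) x) P.fst :=
    (hf.sub hg).integrable_mul (hf.add hg)
  have hreg : Integrable (fun x => (f - g) x * regFun P x) P.fst := (hf.sub hg).integrable_mul hr
  rw [integral_sqLoss_sub hf hg hy, l2norm_sq, l2norm_sq, ← integral_const_mul,
    ← integral_sub hsum (hreg.const_mul 2),
    ← integral_sub (hf.sub hr).integrable_sq (hg.sub hr).integrable_sq]
  congr with x
  simp only [Pi.sub_apply, Pi.add_apply]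
  ring

theorem abs_integral_sqLoss_sub_sub_le {P' : Measure (X × ℝ)} [IsFiniteMeasure P']
    (hPP' : P'.fst = P.fst) (hf : MemLp f 2 P.fst) (hg : MemLp g 2 P.fst)
    (hy : MemLp Prod.snd 2 P) (hy' : MemLp Prod.snd 2 P') :
    |∫ w, (sqLoss f w - sqLoss g w) ∂P' - ∫ w, (sqLoss f w - sqLoss g w) ∂P|
      ≤ 2 * (l2norm P.fst (f - g) * l2norm P.fst (regFun P' - regFun P)) := by
  have hr := memLp_regFun hy
  have hr' : MemLp (regFun P') 2 P.fst := hPP' ▸ memLp_regFun hy'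
  have hreg {r : X → ℝ} (hr : MemLp r 2 P.fst) : Integrable (fun x => (f - g) x * r x) P.fst :=
    (hf.sub hg).integrable_mul hr
  have hdiff : ∫ x, (f - g) x * (regFun P' - regFun P) x ∂P.fst
      = ∫ x, (f - g) x * regFun P' x ∂P.fst - ∫ x, (f - g) x * regFun P x ∂P.fst := by
    rw [← integral_sub (hreg hr') (hreg hr)]
    simp only [Pi.sub_apply, mul_sub]
  have hCS := abs_integral_mul_le_l2norm_mul_l2norm (hf.sub hg) (hr'.sub hr)
  rw [integral_sqLoss_sub (hPP'.symm ▸ hf) (hPP'.symm ▸ hg) hy', integral_sqLoss_sub hf hg hy, hPP',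
    sub_sub_sub_cancel_left, ← mul_sub, abs_mul, abs_two, abs_sub_comm, ← hdiff]
  gcongr

theorem measurable_sqLoss_sub (hf : Measurable f) (hg : Measurable g) :
    Measurable fun w => sqLoss f w - sqLoss g w := by
  unfold sqLoss
  fun_prop

theorem integral_sqLoss_sub_sq_le {M₀ : ℝ} (hf : Measurable f)
    (hg : Measurable g) (hfb : ∀ x, |f x| ≤ M₀) (hgb : ∀ x, |g x| ≤ M₀) (hy : ∀ᵐ w ∂P, |w.2| ≤ M₀) :
    ∫ w, (sqLoss f w - sqLoss g w) ^ 2 ∂P ≤ (4 * M₀ * l2norm P.fst (f - g)) ^ 2 := by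
  have hfg : MemLp (f - g) 2 P.fst :=
    (MemLp.of_bound hf.aestronglyMeasurable M₀ (.of_forall hfb)).sub
      (.of_bound hg.aestronglyMeasurable M₀ (.of_forall hgb))
  have hint := (hfg.comp_measurePreserving ⟨measurable_fst, rfl⟩ :
    MemLp (fun w : X × ℝ => (f - g) w.1) 2 P).integrable_sq
  rw [mul_pow, l2norm_sq, Measure.fst, integral_map measurable_fst.aemeasurable
    hfg.integrable_sq.aestronglyMeasurable, ← integral_const_mul]
  refine integral_mono_of_nonneg (.of_forall fun w => sq_nonneg _) (hint.const_mul _) ?_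
  filter_upwards [hy] with w hw
  have hsum : |f w.1 + g w.1 - 2 * w.2| ≤ 4 * M₀ := by
    have hfw := abs_le.1 (hfb w.1)
    have hgw := abs_le.1 (hgb w.1)
    have hyw := abs_le.1 hw
    exact abs_le.2 ⟨by linarith, by linarith⟩
  calc (sqLoss f w - sqLoss g w) ^ 2
      = |f w.1 + g w.1 - 2 * w.2| ^ 2 * (f - g) w.1 ^ 2 := by
        rw [sq_abs, Pi.sub_apply, sqLoss, sqLoss]
        ring
    _ ≤ (4 * M₀) ^ 2 * (f - g) w.1 ^ 2 := by gcongr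

end Regression

/-! ### The oracle inequality -/

section Comparison

variable {X : Type*} {B : ℕ → ℕ} {m t : ℕ} {data : (j : ℕ) → Fin (B j) → X × ℝ} {M δ' : ℝ}
  {f : Fin m → X → ℝ}

theorem le_add_of_sq_sub_sq_le {a b C ε : ℝ} (hC : 0 ≤ C) (hb : 0 ≤ b) (hε : 0 < ε)
    (h : a ^ 2 - b ^ 2 ≤ C * ((a + b) * ε + ε ^ 2)) : a ≤ b + (C + 1) * ε := by
  by_contra! hlt
  have hdiff : ε < a - b - C * ε := by linarith
  have hsum : (C + 1) * ε < a + b := by linarith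
  have hprod : ε * ((C + 1) * ε) < (a - b - C * ε) * (a + b) :=
    mul_lt_mul'' hdiff hsum hε.le (by positivity)
  linarith [sq_nonneg ε]

theorem IsComparisonOutput.le_add {a b c : Fin m} (h : IsComparisonOutput data M δ' t f a b c)
    {v : Fin m → ℝ} (hv : ∀ r, 0 ≤ v r) {C ε : ℝ} (hC : 0 ≤ C) (hε : 0 < ε)
    (hdev : ∀ k, IsSelectedWindow (lossDiff data (f a) (f b)) M δ' t k →
      |winMean (lossDiff data (f a) (f b)) t k - (v a ^ 2 - v b ^ 2)|
        ≤ C * ((v a + v b) * ε + ε ^ 2)) :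
    v c ≤ v a + (C + 1) * ε ∧ v c ≤ v b + (C + 1) * ε := by
  obtain ⟨k, hk, rfl⟩ := h
  have habs := abs_le.1 (hdev k hk)
  have hle (r) : v r ≤ v r + (C + 1) * ε := le_add_of_nonneg_right (by positivity)
  split_ifs with hmean
  · exact ⟨hle a, le_add_of_sq_sub_sq_le hC (hv b) hε (by linarith)⟩
  · refine ⟨le_add_of_sq_sub_sq_le hC (hv a) hε ?_, hle b⟩
    rw [add_comm (v b)]
    linarith

theorem IsTournamentOutput.le_add {r : Fin m} (hr : IsTournamentOutput data M δ' t f r)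
    {v : Fin m → ℝ} (hv : ∀ r, 0 ≤ v r) {C ε : ℝ} (hC : 0 ≤ C) (hε : 0 < ε)
    (hdev : ∀ a b k, IsSelectedWindow (lossDiff data (f a) (f b)) M δ' t k →
      |winMean (lossDiff data (f a) (f b)) t k - (v a ^ 2 - v b ^ 2)|
        ≤ C * ((v a + v b) * ε + ε ^ 2)) (r' : Fin m) :
    v r ≤ v r' + Nat.clog 2 m * ((C + 1) * ε) := by
  obtain ⟨y, hy, hle⟩ := IsRounds.exists_le (by positivity)
    (fun a b c h => h.le_add hv hC hε (hdev a b)) hr r' (List.mem_finRange r')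
  rwa [List.mem_singleton.1 hy, nsmul_eq_mul] at hle

theorem exists_isTournamentOutput (data : (j : ℕ) → Fin (B j) → X × ℝ) (M δ' : ℝ) (ht : 1 ≤ t)
    (hm : 1 ≤ m) (f : Fin m → X → ℝ) : ∃ r, IsTournamentOutput data M δ' t f r := by
  refine exists_isRounds_singleton (fun a b => ?_) _ _ ?_ ?_
  · obtain ⟨k, hk⟩ := exists_isSelectedWindow (lossDiff data (f a) (f b)) M δ' ht
    exact ⟨_, k, hk, rfl⟩
  · rwa [List.length_finRange]
  · rw [List.length_finRange]
    exact Nat.le_pow_clog one_lt_two m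

end Comparison

section Oracle

variable {X : Type*} [MeasurableSpace X] {P : ℕ → Measure (X × ℝ)} [∀ j, IsFiniteMeasure (P j)]
  {PX : Measure X} {t k : ℕ}

/-- The nonstationarity `max ‖f_j^* - f_t^*‖_P` over the periods `j` of the window
`window t k`. -/
noncomputable def maxDrift (PX : Measure X) (P : ℕ → Measure (X × ℝ)) [∀ j, IsFiniteMeasure (P j)]
    (t k : ℕ) : ℝ :=
  ⨆ j : window t k, l2norm PX (fun x => regFun (P j) x - regFun (P t) x)

theorem l2norm_regFun_sub_le_maxDrift {j : ℕ} (hj : j ∈ window t k) :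
    l2norm PX (regFun (P j) - regFun (P t)) ≤ maxDrift PX P t k :=
  le_ciSup (f := fun j : window t k => l2norm PX (regFun (P j) - regFun (P t)))
    (Set.finite_range _).bddAbove ⟨j, hj⟩

theorem maxDrift_nonneg : 0 ≤ maxDrift PX P t k :=
  Real.iSup_nonneg fun _ => l2norm_nonneg _ _

theorem maxDrift_mono : Monotone (maxDrift PX P t) := fun _ _ h =>
  Real.iSup_le (fun j => l2norm_regFun_sub_le_maxDrift (window_mono t h j.2)) maxDrift_nonneg

variable {B : ℕ → ℕ} {data : (j : ℕ) → Fin (B j) → X × ℝ} {M₀ δ' : ℝ}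

theorem abs_winMean_lossDiff_sub_le {f g : X → ℝ} (hB : 1 ≤ B t) (hM₀ : 0 ≤ M₀)
    (hL : 1 ≤ log (2 / δ')) (hf : MemLp f 2 PX) (hg : MemLp g 2 PX)
    (hy : ∀ j ∈ Finset.Icc 1 t, MemLp Prod.snd 2 (P j))
    (hPX : ∀ j ∈ Finset.Icc 1 t, (P j).fst = PX)
    (hconc : IsWellConcentrated (lossDiff data f g)
      (fun j => ∫ w, (sqLoss f w - sqLoss g w) ∂(P j)) (4 * M₀ ^ 2)
      (4 * M₀ * l2norm PX (f - g)) δ' t)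
    {s : ℕ} (hs : IsSelectedWindow (lossDiff data f g) (2 * (4 * M₀ ^ 2)) δ' t s)
    (hk : k ∈ Finset.Icc 1 t) :
    |winMean (lossDiff data f g) t s
        - (l2norm PX (f - regFun (P t)) ^ 2 - l2norm PX (g - regFun (P t)) ^ 2)|
      ≤ (6 + 36 * M₀ + 156 * M₀ ^ 2)
        * ((l2norm PX (f - regFun (P t)) + l2norm PX (g - regFun (P t)))
            * (maxDrift PX P t k + √(log (2 / δ') / winSize B t k))
          + (maxDrift PX P t k + √(log (2 / δ') / winSize B t k)) ^ 2) := by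
  have ht : t ∈ Finset.Icc 1 t := window_subset_Icc t k (self_mem_window hk)
  obtain rfl := hPX t ht
  have hyt := hy t ht
  have hd : l2norm _ (f - g) ≤ _ := l2norm_sub_le hf hg (memLp_regFun hyt)
  have hd0 := l2norm_nonneg (P t).fst (f - g)
  have hdrift (k) (_hk : k ∈ Finset.Icc 1 t) (j) (hj : j ∈ window t k) :=
    (abs_integral_sqLoss_sub_sub_le (hPX j (window_subset_Icc t k hj)) hf hg hyt
      (hy j (window_subset_Icc t k hj))).trans (mul_le_mul_of_nonneg_left
        (mul_le_mul_of_nonneg_left (l2norm_regFun_sub_le_maxDrift hj) hd0) zero_le_two)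
  have hmain := hconc.abs_winMean_selected_sub_le hB (by positivity) (by positivity) hL hs
    (fun i _ k _ hik => mul_le_mul_of_nonneg_left
      (mul_le_mul_of_nonneg_left (maxDrift_mono hik) hd0) zero_le_two)
    (fun k => mul_nonneg zero_le_two (mul_nonneg hd0 maxDrift_nonneg)) hdrift hk
  rw [← integral_sqLoss_sub_eq_l2norm hf hg hyt]
  refine hmain.trans ?_
  set d := l2norm (P t).fst (f - g)
  set w := l2norm (P t).fst (f - regFun (P t)) + l2norm (P t).fst (g - regFun (P t))
  set β := maxDrift (P t).fst P t k
  set σ := √(log (2 / δ') / winSize B t k)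
  have hβ : 0 ≤ β := maxDrift_nonneg
  have hσ : 0 ≤ σ := sqrt_nonneg _
  have hw : 0 ≤ w := hd0.trans hd
  calc 3 * (2 * (d * β)) + 9 * (4 * M₀ * d) * σ + 39 * (4 * M₀ ^ 2) * σ ^ 2
      = 6 * (d * β) + 36 * M₀ * (d * σ) + 156 * M₀ ^ 2 * σ ^ 2 := by ring
    _ ≤ 6 * (w * (β + σ) + (β + σ) ^ 2) + 36 * M₀ * (w * (β + σ) + (β + σ) ^ 2)
          + 156 * M₀ ^ 2 * (w * (β + σ) + (β + σ) ^ 2) := by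
        gcongr
        · exact le_add_of_le_of_nonneg (by gcongr; linarith) (sq_nonneg _)
        · exact le_add_of_le_of_nonneg (by gcongr; linarith) (sq_nonneg _)
        · exact le_add_of_nonneg_of_le (by positivity) (by gcongr; linarith)
    _ = _ := by ring

variable {m : ℕ} {f : Fin m → X → ℝ}

theorem IsTournamentOutput.l2norm_le (hB : 1 ≤ B t) (hM₀ : 0 ≤ M₀) (hL : 1 ≤ log (2 / δ'))
    (hf : ∀ r, MemLp (f r) 2 PX) (hy : ∀ j ∈ Finset.Icc 1 t, MemLp Prod.snd 2 (P j))
    (hPX : ∀ j ∈ Finset.Icc 1 t, (P j).fst = PX)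
    (hconc : ∀ a b, IsWellConcentrated (lossDiff data (f a) (f b))
      (fun j => ∫ w, (sqLoss (f a) w - sqLoss (f b) w) ∂(P j)) (4 * M₀ ^ 2)
      (4 * M₀ * l2norm PX (f a - f b)) δ' t)
    {r : Fin m} (hr : IsTournamentOutput data (2 * (4 * M₀ ^ 2)) δ' t f r) {Λ : ℝ}
    (hLΛ : log (2 / δ') ≤ 2 * Λ) (hmΛ : (Nat.clog 2 m : ℝ) ≤ 2 * Λ)
    (hk : k ∈ Finset.Icc 1 t) (r' : Fin m) :
    l2norm PX (f r - regFun (P t)) ≤ l2norm PX (f r' - regFun (P t))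
      + 4 * (7 + 36 * M₀ + 156 * M₀ ^ 2) * Λ ^ 2
        * (maxDrift PX P t k + 1 / √(winSize B t k)) := by
  have hβ : 0 ≤ maxDrift PX P t k := maxDrift_nonneg
  have hn : (0 : ℝ) < winSize B t k := Nat.cast_pos.2 (one_le_winSize hB hk)
  have hΛ : 1 ≤ 2 * Λ := hL.trans hLΛ
  have hσ : √(log (2 / δ') / winSize B t k) ≤ 2 * Λ * (1 / √(winSize B t k)) := by
    rw [sqrt_div (by linarith), mul_one_div]
    gcongr
    exact (sqrt_le_self_iff.2 (.inr hL)).trans hLΛ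
  have hε : 0 < maxDrift PX P t k + √(log (2 / δ') / winSize B t k) :=
    add_pos_of_nonneg_of_pos hβ (sqrt_pos.2 (by positivity))
  refine (hr.le_add (v := fun r => l2norm PX (f r - regFun (P t))) (fun _ => l2norm_nonneg _ _)
    (by positivity) hε (fun a b s hs => abs_winMean_lossDiff_sub_le hB hM₀ hL (hf a) (hf b) hy hPX
      (hconc a b) hs hk) r').trans (add_le_add_right ?_ _)
  calc Nat.clog 2 m * ((6 + 36 * M₀ + 156 * M₀ ^ 2 + 1)
        * (maxDrift PX P t k + √(log (2 / δ') / winSize B t k)))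
      ≤ 2 * Λ * ((6 + 36 * M₀ + 156 * M₀ ^ 2 + 1)
        * (2 * Λ * maxDrift PX P t k + 2 * Λ * (1 / √(winSize B t k)))) := by
        gcongr
        exact le_mul_of_one_le_left hβ hΛ
    _ = _ := by ring

theorem IsTournamentOutput.l2norm_sub_iInf_le (ht : 1 ≤ t) (hB : 1 ≤ B t) (hM₀ : 0 ≤ M₀)
    (hL : 1 ≤ log (2 / δ')) (hf : ∀ r, MemLp (f r) 2 PX)
    (hy : ∀ j ∈ Finset.Icc 1 t, MemLp Prod.snd 2 (P j))
    (hPX : ∀ j ∈ Finset.Icc 1 t, (P j).fst = PX)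
    (hconc : ∀ a b, IsWellConcentrated (lossDiff data (f a) (f b))
      (fun j => ∫ w, (sqLoss (f a) w - sqLoss (f b) w) ∂(P j)) (4 * M₀ ^ 2)
      (4 * M₀ * l2norm PX (f a - f b)) δ' t)
    {r : Fin m} (hr : IsTournamentOutput data (2 * (4 * M₀ ^ 2)) δ' t f r) {Λ : ℝ}
    (hLΛ : log (2 / δ') ≤ 2 * Λ) (hmΛ : (Nat.clog 2 m : ℝ) ≤ 2 * Λ) :
    l2norm PX (f r - regFun (P t)) - ⨅ r', l2norm PX (f r' - regFun (P t))
      ≤ 4 * (7 + 36 * M₀ + 156 * M₀ ^ 2) * Λ ^ 2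
        * ⨅ k : Finset.Icc 1 t, (maxDrift PX P t k + 1 / √(winSize B t k)) := by
  have : Nonempty (Fin m) := ⟨r⟩
  have : Nonempty (Finset.Icc 1 t) := ⟨⟨t, Finset.mem_Icc.2 ⟨ht, le_rfl⟩⟩⟩
  rw [Real.mul_iInf_of_nonneg (by positivity)]
  exact le_ciInf fun k => sub_le_comm.1 <| le_ciInf fun r' => sub_le_iff_le_add.2 <|
    hr.l2norm_le hB hM₀ hL hf hy hPX hconc hLΛ hmΛ k.2 r'

end Oracle

section Logarithms

theorem one_add_log_sum_le_mul {x y w : ℝ} (hx : 0 ≤ x) (hy : 0 ≤ y) (hw : 0 ≤ w) :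
    1 + x + y + w ≤ (1 + x) * (1 + y) * (1 + w) := by
  have hxy : 1 + (x + y) ≤ (1 + x) * (1 + y) := by linarith [mul_nonneg hx hy]
  have hxyw := mul_le_mul_of_nonneg_right hxy (by linarith : 0 ≤ 1 + w)
  linarith [mul_nonneg (add_nonneg hx hy) hw]

theorem clog_two_le (m : ℕ) : (Nat.clog 2 m : ℝ) ≤ 1 + 2 * log m := by
  have hlog : 0 ≤ log m := log_natCast_nonneg m
  have hlogb : logb 2 m ≤ 2 * log m := by
    rw [logb, div_le_iff₀ (log_pos one_lt_two)]
    linarith [mul_le_mul_of_nonneg_left (log_two_gt_d9.le) hlog]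
  have hceil := Nat.ceil_lt_add_one (a := logb 2 m) (div_nonneg hlog (log_nonneg one_le_two))
  have hclog : ⌈logb 2 m⌉₊ = Nat.clog 2 m := mod_cast Real.natCeil_logb_natCast 2 m
  rw [← hclog]
  linarith

variable {m t : ℕ} {δ : ℝ}

theorem log_two_div_eq (hm : 1 ≤ m) (ht : 1 ≤ t) (hδ : 0 < δ) :
    log (2 / (δ / (3 * (m : ℝ) ^ 2 * t))) = log 6 + 2 * log m + log t + log (1 / δ) := by
  have hm0 : (m : ℝ) ≠ 0 := by positivity
  have ht0 : (t : ℝ) ≠ 0 := by positivity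
  have hmul : 2 / (δ / (3 * (m : ℝ) ^ 2 * t)) = 6 * (m : ℝ) ^ 2 * t * (1 / δ) := by
    field_simp
    norm_num
  rw [hmul, log_mul (by positivity) (by positivity), log_mul (by positivity) ht0,
    log_mul (by positivity) (by positivity), log_pow, Nat.cast_two]

theorem one_le_log_two_div (hm : 1 ≤ m) (ht : 1 ≤ t) (hδ : 0 < δ) (hδ1 : δ ≤ 1) :
    1 ≤ log (2 / (δ / (3 * (m : ℝ) ^ 2 * t))) := by
  have hlog6 : 1 ≤ log 6 := by
    rw [le_log_iff_exp_le (by norm_num)]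
    linarith [exp_one_lt_three]
  rw [log_two_div_eq hm ht hδ]
  linarith [log_natCast_nonneg m, log_natCast_nonneg t, log_nonneg ((one_le_div hδ).2 hδ1)]

theorem log_two_div_le (hm : 1 ≤ m) (ht : 1 ≤ t) (hδ : 0 < δ) (hδ1 : δ ≤ 1) :
    log (2 / (δ / (3 * (m : ℝ) ^ 2 * t)))
      ≤ 2 * ((1 + log m) * (1 + log t) * (1 + log (1 / δ))) := by
  have hlog6 : log 6 ≤ 2 := by
    rw [log_le_iff_le_exp (by norm_num), ← one_add_one_eq_two, exp_add]
    nlinarith [exp_one_gt_d9]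
  have hlogδ := log_nonneg ((one_le_div hδ).2 hδ1)
  rw [log_two_div_eq hm ht hδ]
  linarith [one_add_log_sum_le_mul (log_natCast_nonneg m) (log_natCast_nonneg t) hlogδ,
    log_natCast_nonneg t]

theorem clog_two_le_mul (m t : ℕ) (hδ : 0 < δ) (hδ1 : δ ≤ 1) :
    (Nat.clog 2 m : ℝ) ≤ 2 * ((1 + log m) * (1 + log t) * (1 + log (1 / δ))) := by
  have hlogδ := log_nonneg ((one_le_div hδ).2 hδ1)
  linarith [one_add_log_sum_le_mul (log_natCast_nonneg m) (log_natCast_nonneg t) hlogδ,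
    clog_two_le m, log_natCast_nonneg t]

end Logarithms

section Probability

variable {X : Type*} [MeasurableSpace X] {Ω : Type*} [MeasurableSpace Ω] {μ : Measure Ω}
  [IsProbabilityMeasure μ] {B : ℕ → ℕ} {P : ℕ → Measure (X × ℝ)} {PX : Measure X}
  {z : (j : ℕ) → Fin (B j) → Ω → X × ℝ} {M₀ δ' : ℝ} {t : ℕ}

theorem ofReal_one_sub_le_measure {p : Ω → Prop} {δ : ℝ} (hp : μ.real {ω | ¬ p ω} ≤ δ) :
    ENNReal.ofReal (1 - δ) ≤ μ {ω | p ω} := by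
  have hunion := measureReal_union_le (μ := μ) {ω | p ω} {ω | p ω}ᶜ
  rw [Set.union_compl_self, probReal_univ] at hunion
  exact ENNReal.ofReal_le_of_le_toReal (by linarith! [hp])

theorem measureReal_not_isWellConcentrated_lossDiff_le (hB : 1 ≤ B t)
    (hz : ∀ j ∈ Finset.Icc 1 t, ∀ i, MeasurePreserving (z j i) μ (P j))
    (hind : iIndepFun (fun s : (j : Finset.Icc 1 t) × Fin (B j) => z s.1 s.2) μ) (hM₀ : 0 < M₀)
    (hy : ∀ j ∈ Finset.Icc 1 t, ∀ᵐ w ∂(P j), |w.2| ≤ M₀)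
    (hPX : ∀ j ∈ Finset.Icc 1 t, (P j).fst = PX) (hδ' : 0 < δ') (hL : 0 < log (2 / δ'))
    {f g : X → ℝ} (hf : Measurable f) (hg : Measurable g)
    (hfb : ∀ x, |f x| ≤ M₀) (hgb : ∀ x, |g x| ≤ M₀) :
    μ.real {ω | ¬ IsWellConcentrated (lossDiff (fun j i => z j i ω) f g)
      (fun j => ∫ w, (sqLoss f w - sqLoss g w) ∂(P j)) (4 * M₀ ^ 2)
      (4 * M₀ * l2norm PX (f - g)) δ' t} ≤ 2 * t * δ' := by
  have hloss := measurable_sqLoss_sub hf hg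
  have hmap {φ : X × ℝ → ℝ} (hφ : Measurable φ) (j) (hj : j ∈ Finset.Icc 1 t) (i) :
      ∫ ω, φ (z j i ω) ∂μ = ∫ w, φ w ∂(P j) := by
    rw [← (hz j hj i).map_eq,
      integral_map (hz j hj i).measurable.aemeasurable hφ.aestronglyMeasurable]
  refine measureReal_not_isWellConcentrated_le
    (U := fun j i ω => sqLoss f (z j i ω) - sqLoss g (z j i ω)) hB (hind.comp _ fun _ => hloss)
    (fun j hj i => hloss.comp (hz j hj i).measurable) (by positivity) (fun j hj i => ?_)
    (hmap hloss) (fun j hj i => ?_) hδ' hL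
  · filter_upwards [(hz j hj i).quasiMeasurePreserving.ae (hy j hj)] with ω hω
    exact abs_sqLoss_sub_le hfb hgb hω
  · have : IsFiniteMeasure (P j) := (hz j hj i).map_eq ▸ inferInstance
    rw [hmap (hloss.pow_const 2) j hj i, ← hPX j hj]
    exact integral_sqLoss_sub_sq_le hf hg hfb hgb (hy j hj)

theorem measureReal_not_forall_isWellConcentrated_lossDiff_le (hB : 1 ≤ B t)
    (hz : ∀ j ∈ Finset.Icc 1 t, ∀ i, MeasurePreserving (z j i) μ (P j))
    (hind : iIndepFun (fun s : (j : Finset.Icc 1 t) × Fin (B j) => z s.1 s.2) μ) (hM₀ : 0 < M₀)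
    (hy : ∀ j ∈ Finset.Icc 1 t, ∀ᵐ w ∂(P j), |w.2| ≤ M₀)
    (hPX : ∀ j ∈ Finset.Icc 1 t, (P j).fst = PX) (hδ' : 0 < δ') (hL : 0 < log (2 / δ'))
    {m : ℕ} {f : Fin m → X → ℝ} (hf : ∀ r, Measurable (f r)) (hfb : ∀ r x, |f r x| ≤ M₀) :
    μ.real {ω | ¬ ∀ a b, IsWellConcentrated (lossDiff (fun j i => z j i ω) (f a) (f b))
      (fun j => ∫ w, (sqLoss (f a) w - sqLoss (f b) w) ∂(P j)) (4 * M₀ ^ 2)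
      (4 * M₀ * l2norm PX (f a - f b)) δ' t} ≤ 2 * (m : ℝ) ^ 2 * t * δ' := by
  let bad (q : Fin m × Fin m) : Set Ω :=
    {ω | ¬ IsWellConcentrated (lossDiff (fun j i => z j i ω) (f q.1) (f q.2))
      (fun j => ∫ w, (sqLoss (f q.1) w - sqLoss (f q.2) w) ∂(P j)) (4 * M₀ ^ 2)
      (4 * M₀ * l2norm PX (f q.1 - f q.2)) δ' t}
  have hbad (q) : μ.real (bad q) ≤ 2 * t * δ' :=
    measureReal_not_isWellConcentrated_lossDiff_le hB hz hind hM₀ hy hPX hδ' hL (hf q.1) (hf q.2)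
      (hfb q.1) (hfb q.2)
  calc _ ≤ μ.real (⋃ q, bad q) :=
        measureReal_mono (fun ω hω => by simpa [bad] using hω) (measure_ne_top _ _)
    _ ≤ ∑ q, μ.real (bad q) := measureReal_iUnion_fintype_le _
    _ ≤ Fintype.card (Fin m × Fin m) * (2 * t * δ') :=
        (Finset.sum_le_card_nsmul _ _ _ fun q _ => hbad q).trans_eq (nsmul_eq_mul _ _)
    _ = 2 * (m : ℝ) ^ 2 * t * δ' := by
        rw [Fintype.card_prod, Fintype.card_fin, Nat.cast_mul]
        ring

end Probability

end RollingWindow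

theorem mainTheorem4 :
    ∃ p : ℕ, ∀ M₀ : ℝ, 0 < M₀ → ∃ C : ℝ, 0 < C ∧
      ∀ (X : Type*) [MeasurableSpace X] (Ω : Type*) [MeasurableSpace Ω]
        (μ : Measure Ω) [IsProbabilityMeasure μ]
        -- current time, batch sizes, data distributions, covariate distribution
        (t : ℕ) (B : ℕ → ℕ) (P : ℕ → Measure (X × ℝ)) [∀ j, IsProbabilityMeasure (P j)]
        (PX : Measure X)
        -- samples
        (z : (j : ℕ) → Fin (B j) → Ω → X × ℝ)
        -- candidate models
        (m : ℕ) (f : Fin m → X → ℝ) (δ : ℝ),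
        1 ≤ t → (∀ j ∈ Finset.Icc 1 t, 1 ≤ B j) →
        -- the samples are independent, and those of period `j` are drawn from `P j`
        (∀ j ∈ Finset.Icc 1 t, ∀ i : Fin (B j), Measurable (z j i) ∧ μ.map (z j i) = P j) →
        iIndepFun (fun (s : (j : Finset.Icc 1 t) × Fin (B j)) => z s.1 s.2) μ →
        -- bounded response, bounded models, no covariate shift
        (∀ j ∈ Finset.Icc 1 t, ∀ᵐ w ∂(P j), |w.2| ≤ M₀) →
        1 ≤ m → (∀ r, Measurable (f r)) → (∀ r x, |f r x| ≤ M₀) →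
        (∀ j ∈ Finset.Icc 1 t, (P j).map Prod.fst = PX) →
        0 < δ → δ < 1 →
        ENNReal.ofReal (1 - δ) ≤ μ {ω |
          (∃ r, RollingWindow.IsTournamentOutput (fun j i => z j i ω) (8 * M₀ ^ 2)
            (δ / (3 * (m : ℝ) ^ 2 * t)) t f r) ∧
          ∀ r, RollingWindow.IsTournamentOutput (fun j i => z j i ω) (8 * M₀ ^ 2)
              (δ / (3 * (m : ℝ) ^ 2 * t)) t f r →
            RollingWindow.l2norm PX (fun x => f r x - RollingWindow.regFun (P t) x)
                - ⨅ r' : Fin m,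
                    RollingWindow.l2norm PX (fun x => f r' x - RollingWindow.regFun (P t) x)
              ≤ C * ((1 + Real.log m) * (1 + Real.log t) * (1 + Real.log (1 / δ))) ^ p *
                ⨅ k : Finset.Icc 1 t,
                  ((⨆ j : RollingWindow.window t k,
                      RollingWindow.l2norm PX (fun x =>
                        RollingWindow.regFun (P j) x - RollingWindow.regFun (P t) x))
                    + 1 / Real.sqrt (RollingWindow.winSize B t k))} := by
  refine ⟨2, fun M₀ hM₀ => ⟨4 * (7 + 36 * M₀ + 156 * M₀ ^ 2), by positivity, ?_⟩⟩
  intro X _ Ω _ μ _ t B P _ PX z m f δ ht hB hz hind hy hm hf hfb hPX hδ hδ1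
  have htmem : t ∈ Finset.Icc 1 t := Finset.right_mem_Icc.2 ht
  have hPXfin : IsFiniteMeasure PX := hPX t htmem ▸ inferInstance
  have hL := RollingWindow.one_le_log_two_div hm ht hδ hδ1.le
  have hbad := RollingWindow.measureReal_not_forall_isWellConcentrated_lossDiff_le (hB t htmem)
    (fun j hj i => ⟨(hz j hj i).1, (hz j hj i).2⟩) hind hM₀ hy hPX (by positivity)
    (zero_lt_one.trans_le hL) hf hfb
  have hprob : 2 * (m : ℝ) ^ 2 * t * (δ / (3 * (m : ℝ) ^ 2 * t)) ≤ δ := by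
    rw [mul_div_assoc', div_le_iff₀ (by positivity)]
    nlinarith [show 0 < (m : ℝ) ^ 2 * t * δ by positivity]
  refine (RollingWindow.ofReal_one_sub_le_measure (hbad.trans hprob)).trans
    (measure_mono fun ω hω => ⟨RollingWindow.exists_isTournamentOutput _ _ _ ht hm f, ?_⟩)
  rw [show 8 * M₀ ^ 2 = 2 * (4 * M₀ ^ 2) by ring]
  intro r hr
  exact hr.l2norm_sub_iInf_le ht (hB t htmem) hM₀.le hL
    (fun r => .of_bound (hf r).aestronglyMeasurable M₀ (.of_forall (hfb r)))
    (fun j hj => .of_bound measurable_snd.aestronglyMeasurable M₀ (hy j hj)) hPX hω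
    (RollingWindow.log_two_div_le hm ht hδ hδ1.le) (RollingWindow.clog_two_le_mul m t hδ hδ1.le)
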